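/- Let $k,l,m$ be integers with $m\ge 2$, $k>l\ge 3$ and $\gcd(k,l)=1$, and let $X\subset\mathbb C^5$ be the hypersurface given in coordinates $(x,y,z,u,v)$ by the equation $$p=u^mv+\frac{(xz+1)^k-(yz+1)^l+z}{z}=0$$ (the fraction is a polynomial in $x,y,z$). For an affine variety $Y$ over $\mathbb C$, with algebra of regular functions $\mathbb C[Y]$, let the Makar-Limanov invariant $\mathrm{ML}(Y)\subset\mathbb C[Y]$ be the subalgebra of those regular functions that are annihilated by every locally nilpotent $\mathbb C$-derivation of $\mathbb C[Y]$. Put $\bar u=u|_X\in\mathbb C[X]$. Then $\mathrm{ML}(X)\supset\mathbb C[\bar u]$; in other words, every locally nilpotent derivation of $\mathbb C[X]$ annihilates $\bar u$. Moreover $\mathrm{ML}(X)\ne\mathbb C$ and $\mathrm{ML}(\mathbb C^4)=\mathbb C$, so that $\mathrm{ML}(X)\not\simeq\mathrm{ML}(\mathbb C^4)$ as $\mathbb C$-algebras, and therefore $X$ is not isomorphic to $\mathbb C^4$ as an algebraic variety. -/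

import Mathlib

/-- The algebra `ℂ[X]` of regular functions on a Zariski closed subset `X` of affine space `ℂ^σ`:
the functions on `X` that are restrictions of polynomials. -/
def regularFunctions {σ : Type*} (X : Set (σ → ℂ)) : Subalgebra ℂ (X → ℂ) where
  carrier := {f | ∃ p : MvPolynomial σ ℂ, ∀ a : X, f a = MvPolynomial.eval a.1 p}
  mul_mem' := by
    rintro f g ⟨p, hp⟩ ⟨q, hq⟩
    exact ⟨p * q, fun a => by simp [hp, hq]⟩
  add_mem' := by
    rintro f g ⟨p, hp⟩ ⟨q, hq⟩
    exact ⟨p + q, fun a => by simp [hp, hq]⟩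
  algebraMap_mem' := fun c => ⟨MvPolynomial.C c, fun a => by simp⟩

/-- The restriction to `X` of the `i`-th coordinate function. -/
def coordFunction {σ : Type*} (X : Set (σ → ℂ)) (i : σ) : regularFunctions X :=
  ⟨fun a => a.1 i, MvPolynomial.X i, fun a => by simp⟩

/-- A map between Zariski closed subsets of affine spaces is regular (a morphism of affine
varieties) if all of its components are regular functions. -/
def IsRegularMap {σ τ : Type*} {X : Set (σ → ℂ)} {Y : Set (τ → ℂ)} (f : X → Y) : Prop :=
  ∀ j : τ, (fun a : X => (f a).1 j) ∈ regularFunctions X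

/-- Two Zariski closed subsets of affine spaces are isomorphic as affine varieties:
there is a bijection between them that is regular in both directions. -/
def BiregularlyIsomorphic {σ τ : Type*} (X : Set (σ → ℂ)) (Y : Set (τ → ℂ)) : Prop :=
  ∃ e : X ≃ Y, IsRegularMap (e : X → Y) ∧ IsRegularMap (e.symm : Y → X)

/-- A `ℂ`-derivation `∂` of a commutative `ℂ`-algebra `A` is locally nilpotent if every
element of `A` is annihilated by some power of `∂`. -/
def IsLocallyNilpotentDerivation {A : Type*} [CommRing A] [Algebra ℂ A]
    (D : Derivation ℂ A A) : Prop :=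
  ∀ a : A, ∃ n : ℕ, (⇑D)^[n] a = 0

/-- The Makar-Limanov invariant of a commutative `ℂ`-algebra: the subalgebra of the elements that
are annihilated by every locally nilpotent derivation. -/
def makarLimanovAlgebra (A : Type*) [CommRing A] [Algebra ℂ A] : Subalgebra ℂ A where
  carrier := {a | ∀ D : Derivation ℂ A A, IsLocallyNilpotentDerivation D → D a = 0}
  mul_mem' := by
    intro a b ha hb D hD
    simp [ha D hD, hb D hD]
  add_mem' := by
    intro a b ha hb D hD
    simp [ha D hD, hb D hD]
  algebraMap_mem' := fun c D _ => by simp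

/-- The Makar-Limanov invariant `ML(X)` of a Zariski closed subset `X` of affine space. -/
def ML {σ : Type*} (X : Set (σ → ℂ)) : Subalgebra ℂ (regularFunctions X) :=
  makarLimanovAlgebra (regularFunctions X)

namespace MiyanishiHypersurface

/-- The polynomial `q_{k,l} = ((xz + 1)^k - (yz + 1)^l + z) / z`, expanded, as a function on a
commutative ring. The lemma `mul_q` below says that it is this quotient. -/
def q {R : Type*} [CommRing R] (k l : ℕ) (x y z : R) : R :=
  (∑ i ∈ Finset.range k, (k.choose (i + 1) : R) * x ^ (i + 1) * z ^ i)
    - (∑ j ∈ Finset.range l, (l.choose (j + 1) : R) * y ^ (j + 1) * z ^ j) + 1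

theorem mul_sum_choose {R : Type*} [CommRing R] (k : ℕ) (x z : R) :
    z * (∑ i ∈ Finset.range k, (k.choose (i + 1) : R) * x ^ (i + 1) * z ^ i)
      = (x * z + 1) ^ k - 1 := by
  rw [add_pow, Finset.sum_range_succ', Finset.mul_sum]
  simp only [one_pow, mul_one, pow_zero, Nat.choose_zero_right, Nat.cast_one, add_sub_cancel_right]
  refine Finset.sum_congr rfl fun i _ => ?_
  ring

theorem mul_q {R : Type*} [CommRing R] (k l : ℕ) (x y z : R) :
    z * q k l x y z = (x * z + 1) ^ k - (y * z + 1) ^ l + z := by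
  have h1 := mul_sum_choose k x z
  have h2 := mul_sum_choose l y z
  unfold q
  linear_combination h1 - h2

/-- The polynomial `p = u^m v + q_{k,l}(x, y, z)` in five variables, where `x, y, z, u, v` are the
variables with the indices `0, 1, 2, 3, 4`. -/
noncomputable def p (k l m : ℕ) : MvPolynomial (Fin 5) ℂ :=
  MvPolynomial.X 3 ^ m * MvPolynomial.X 4
    + q k l (MvPolynomial.X 0) (MvPolynomial.X 1) (MvPolynomial.X 2)

/-- The hypersurface `p = 0` in `ℂ^5`. -/
def hypersurface (k l m : ℕ) : Set (Fin 5 → ℂ) :=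
  {a | MvPolynomial.eval a (p k l m) = 0}

/-- The restriction to the hypersurface of the coordinate function `u`. -/
def uBar (k l m : ℕ) : regularFunctions (hypersurface k l m) :=
  coordFunction (hypersurface k l m) 3

end MiyanishiHypersurface

/-- The affine space `ℂ^n`, as a closed subset of itself. -/
def affineSpaceC (n : ℕ) : Set (Fin n → ℂ) := Set.univ

/-!
Every locally nilpotent derivation `D` of the algebra `A` of the hypersurface `u ^ m * v + q = 0`
annihilates `u`, because a suitable degeneration of `D` would move points along nonconstant
polynomial curves that the Mason–Stothers theorem forbids.

The torus action `(x, y, z, u, v) ↦ (x, y, z, t u, t⁻ᵐ v)` makes `A` a `ℤ`-graded domain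
(`weightGradedAlgebra`, `isDomain_regularFunctions`) in which a homogeneous element of positive
degree is divisible by `u`, one of negative degree by `v`, and one whose degree is not a multiple of
`m` by `u`. Suppose `D u ≠ 0`. As kernels of locally nilpotent derivations are factorially closed, no
nonzero kernel element has positive order. If all had order zero, division with respect to a local slice
would bound the orders of `u` and `v` in contradictory ways; so `ker D` contains an element of
negative order (`IsLocallyNilpotentDerivation.exists_gradedOrder_neg`). The homogeneous part `E ≠ 0`
of lowest degree of `D` is again locally nilpotent and kills the lowest component of that element,
which is divisible by `v`. Hence `E v = 0`.

Such an `E` must vanish (`IsLocallyNilpotentDerivation.eq_zero_of_homogeneous`). The exponential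
`a ↦ exp(tE) a` restricts functions to the generic orbit. If `E u ≠ 0`, then degree considerations
show that `u` has degree one in `t` and that functions of weight zero have degree divisible by `m`.
With `X = x z + 1` and `Y = y z + 1`, the equation of the hypersurface reads
`Y ^ l - X ^ k = z (1 + v u ^ m)`, whose last factor is squarefree in `t`, of degree at most `m`, or
constant if `E u = 0`. As `X` and `Y` are congruent to `1` modulo `z`, they are coprime to `z` and
hence, `k` and `l` being at least `2`, coprime to each other; for `k ≥ 4`, `l ≥ 3` the
Mason–Stothers inequality makes them constant (`Polynomial.natDegree_eq_zero_of_mason`). So `x`, `y`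
and `z` are constant on the orbits, and then so is `u`.

The remaining claims follow because `u` is not constant, because the partial derivatives are locally
nilpotent and have only the constants in common in their kernels, and because the Makar-Limanov
invariant is functorial for isomorphisms.
-/

/-! ### Locally nilpotent derivations -/

section LocallyNilpotent

open Finset Polynomial
open scoped Nat

variable {A : Type*} [CommRing A] [Algebra ℂ A]

theorem Derivation.iterate_mul (D : Derivation ℂ A A) (n : ℕ) (a b : A) :
    D^[n] (a * b) = ∑ ij ∈ antidiagonal n, n.choose ij.1 • (D^[ij.1] a * D^[ij.2] b) := by
  induction n with
  | zero => simp
  | succ n ih =>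
    rw [Function.iterate_succ_apply', ih, map_sum,
      Finset.sum_antidiagonal_choose_succ_nsmul (fun i j => D^[i] a * D^[j] b),
      ← Finset.sum_add_distrib]
    refine Finset.sum_congr rfl fun ij hij => ?_
    rw [Finset.HasAntidiagonal.mem_antidiagonal] at hij
    rw [Nat.choose_symm_of_eq_add hij.symm, map_nsmul, Derivation.leibniz, nsmul_add,
      Function.iterate_succ_apply', Function.iterate_succ_apply', smul_eq_mul, smul_eq_mul,
      mul_comm (D^[ij.2] b)]

theorem Derivation.iterate_eq_zero_of_le {D : Derivation ℂ A A} {m n : ℕ} (h : m ≤ n) {a : A}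
    (ha : D^[m] a = 0) : D^[n] a = 0 := by
  obtain ⟨j, rfl⟩ := Nat.exists_eq_add_of_le' h
  rw [Function.iterate_add_apply, ha, iterate_map_zero]

theorem Derivation.iterate_mul_left_of_apply_eq_zero {D : Derivation ℂ A A} {c : A} (hc : D c = 0)
    (n : ℕ) (a : A) : D^[n] (c * a) = c * D^[n] a := by
  induction n with
  | zero => rfl
  | succ n ih => simp [Function.iterate_succ_apply', ih, hc]

theorem Derivation.iterate_pow_of_iterate_two_eq_zero {D : Derivation ℂ A A} {s : A}
    (hs : D (D s) = 0) (n : ℕ) : D^[n] (s ^ n) = (n ! : A) * D s ^ n := by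
  induction n with
  | zero => simp
  | succ n ih =>
    have hc : D (((n + 1 : ℕ) : A) * D s) = 0 := by simp [hs]
    rw [Function.iterate_succ_apply, Derivation.leibniz_pow, Nat.add_sub_cancel, nsmul_eq_mul,
      smul_eq_mul,
      show ((n + 1 : ℕ) : A) * (s ^ n * D s) = (((n + 1 : ℕ) : A) * D s) * s ^ n by ring,
      Derivation.iterate_mul_left_of_apply_eq_zero hc, ih, Nat.factorial_succ]
    push_cast
    ring

theorem Derivation.exists_iterate_mul_eq_zero {D : Derivation ℂ A A} {a b : A}
    (ha : ∃ n, D^[n] a = 0) (hb : ∃ n, D^[n] b = 0) : ∃ n, D^[n] (a * b) = 0 := by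
  obtain ⟨i, hi⟩ := ha
  obtain ⟨j, hj⟩ := hb
  refine ⟨i + j, ?_⟩
  rw [D.iterate_mul]
  refine Finset.sum_eq_zero fun ij hij => ?_
  rw [Finset.HasAntidiagonal.mem_antidiagonal] at hij
  rcases le_or_gt i ij.1 with h | h
  · rw [Derivation.iterate_eq_zero_of_le h hi, zero_mul, smul_zero]
  · rw [Derivation.iterate_eq_zero_of_le (by omega : j ≤ ij.2) hj, mul_zero, smul_zero]

theorem Derivation.exists_iterate_add_eq_zero {D : Derivation ℂ A A} {a b : A}
    (ha : ∃ n, D^[n] a = 0) (hb : ∃ n, D^[n] b = 0) : ∃ n, D^[n] (a + b) = 0 := by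
  obtain ⟨i, hi⟩ := ha
  obtain ⟨j, hj⟩ := hb
  refine ⟨max i j, ?_⟩
  rw [iterate_map_add, Derivation.iterate_eq_zero_of_le (le_max_left i j) hi,
    Derivation.iterate_eq_zero_of_le (le_max_right i j) hj, add_zero]

namespace IsLocallyNilpotentDerivation

variable {D : Derivation ℂ A A} (hD : IsLocallyNilpotentDerivation D)

/-- The polynomial `exp(tD) a = ∑ Dⁿ(a) tⁿ / n!` in `t`. -/
noncomputable def expPoly (a : A) : A[X] :=
  ∑ i ∈ range (hD a).choose, monomial i ((i ! : ℂ)⁻¹ • D^[i] a)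

theorem coeff_expPoly (a : A) (n : ℕ) :
    (hD.expPoly a).coeff n = (n ! : ℂ)⁻¹ • D^[n] a := by
  simp only [expPoly, finsetSum_coeff, coeff_monomial, Finset.sum_ite_eq', Finset.mem_range]
  split_ifs with h
  · rfl
  · rw [Derivation.iterate_eq_zero_of_le (not_lt.1 h) (hD a).choose_spec, smul_zero]

/-- The exponential `a ↦ exp(tD) a` of a locally nilpotent derivation. Geometrically, it restricts
regular functions to the orbit of the generic point under the action of the additive group. -/
noncomputable def expHom : A →+* A[X] where
  toFun := hD.expPoly
  map_one' := by
    refine Polynomial.ext fun n => ?_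
    rw [coeff_expPoly, coeff_one]
    cases n with
    | zero => simp
    | succ n => simp [Function.iterate_succ_apply]
  map_zero' := by
    refine Polynomial.ext fun n => ?_
    rw [coeff_expPoly, iterate_map_zero, smul_zero, coeff_zero]
  map_add' a b := by
    refine Polynomial.ext fun n => ?_
    simp only [coeff_expPoly, coeff_add, iterate_map_add, smul_add]
  map_mul' a b := by
    refine Polynomial.ext fun n => ?_
    simp only [coeff_expPoly, coeff_mul, D.iterate_mul, Finset.smul_sum]
    refine Finset.sum_congr rfl fun ij hij => ?_
    rw [HasAntidiagonal.mem_antidiagonal] at hij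
    subst hij
    rw [smul_mul_smul_comm, ← Nat.cast_smul_eq_nsmul ℂ, smul_smul, Nat.choose_symm_add,
      Nat.add_choose,
      Nat.cast_div (Nat.factorial_mul_factorial_dvd_factorial_add _ _)
        (Nat.cast_ne_zero.2 (mul_ne_zero (Nat.factorial_ne_zero _) (Nat.factorial_ne_zero _)))]
    congr 1
    have h1 : ((ij.1 + ij.2)! : ℂ) ≠ 0 := Nat.cast_ne_zero.2 (Nat.factorial_ne_zero _)
    push_cast
    field_simp

theorem coeff_expHom (a : A) (n : ℕ) : (hD.expHom a).coeff n = (n ! : ℂ)⁻¹ • D^[n] a :=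
  hD.coeff_expPoly a n

theorem coeff_expHom_eq_zero_iff (a : A) (n : ℕ) :
    (hD.expHom a).coeff n = 0 ↔ D^[n] a = 0 := by
  rw [coeff_expHom, smul_eq_zero_iff_right]
  exact inv_ne_zero (Nat.cast_ne_zero.2 n.factorial_ne_zero)

theorem expHom_injective : Function.Injective hD.expHom := by
  rw [injective_iff_map_eq_zero]
  intro a ha
  simpa [ha] using hD.coeff_expHom_eq_zero_iff a 0

theorem expHom_ne_zero {a : A} (ha : a ≠ 0) : hD.expHom a ≠ 0 :=
  (map_ne_zero_iff _ hD.expHom_injective).2 ha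

theorem iterate_natDegree_ne_zero {a : A} (ha : a ≠ 0) :
    D^[(hD.expHom a).natDegree] a ≠ 0 := by
  rw [Ne, ← hD.coeff_expHom_eq_zero_iff, coeff_natDegree, leadingCoeff_eq_zero]
  exact hD.expHom_ne_zero ha

theorem iterate_eq_zero_of_natDegree_lt {a : A} {n : ℕ} (h : (hD.expHom a).natDegree < n) :
    D^[n] a = 0 := by
  rw [← hD.coeff_expHom_eq_zero_iff]
  exact coeff_eq_zero_of_natDegree_lt h

theorem natDegree_lt_of_iterate_eq_zero {a : A} {n : ℕ} (ha : a ≠ 0) (h : D^[n] a = 0) :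
    (hD.expHom a).natDegree < n := by
  by_contra! hn
  exact hD.iterate_natDegree_ne_zero ha (Derivation.iterate_eq_zero_of_le hn h)

theorem natDegree_expHom_eq_zero_iff (a : A) : (hD.expHom a).natDegree = 0 ↔ D a = 0 := by
  constructor
  · intro h
    exact hD.iterate_eq_zero_of_natDegree_lt (n := 1) (by omega)
  · intro h
    by_cases ha : a = 0
    · simp [ha]
    · have := hD.natDegree_lt_of_iterate_eq_zero (n := 1) ha h
      omega

theorem expHom_of_apply_eq_zero {a : A} (h : D a = 0) : hD.expHom a = C a := by
  rw [eq_C_of_natDegree_eq_zero ((hD.natDegree_expHom_eq_zero_iff a).2 h), coeff_expHom]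
  simp

theorem apply_iterate_natDegree (a : A) : D (D^[(hD.expHom a).natDegree] a) = 0 := by
  rw [← Function.iterate_succ_apply' (f := D)]
  exact hD.iterate_eq_zero_of_natDegree_lt (Nat.lt_succ_self _)

/-- If `D a ≠ 0`, then the last but one nonzero iterate of `D` on `a` is a local slice. -/
theorem apply_iterate_natDegree_sub_one {a : A} (h : D a ≠ 0) :
    D (D^[(hD.expHom a).natDegree - 1] a) = D^[(hD.expHom a).natDegree] a := by
  have h0 : (hD.expHom a).natDegree ≠ 0 := mt (hD.natDegree_expHom_eq_zero_iff a).1 h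
  rw [← Function.iterate_succ_apply' (f := D), Nat.succ_eq_add_one, Nat.sub_add_cancel (by omega)]

variable [IsDomain A]

theorem natDegree_expHom_mul {a b : A} (ha : a ≠ 0) (hb : b ≠ 0) :
    (hD.expHom (a * b)).natDegree = (hD.expHom a).natDegree + (hD.expHom b).natDegree := by
  rw [map_mul, natDegree_mul (hD.expHom_ne_zero ha) (hD.expHom_ne_zero hb)]

/-- The kernel of a locally nilpotent derivation of a domain is factorially closed. -/
theorem apply_eq_zero_of_dvd (hD : IsLocallyNilpotentDerivation D) {a b : A} (hab : a ∣ b)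
    (hb : b ≠ 0) (h : D b = 0) : D a = 0 := by
  obtain ⟨c, rfl⟩ := hab
  have := hD.natDegree_expHom_mul (left_ne_zero_of_mul hb) (right_ne_zero_of_mul hb)
  rw [(hD.natDegree_expHom_eq_zero_iff _).2 h] at this
  exact (hD.natDegree_expHom_eq_zero_iff _).1 (by omega)

end IsLocallyNilpotentDerivation
end LocallyNilpotent

/-! ### Orders in `ℤ`-graded domains -/

section GradedOrder

open DirectSum

variable {A : Type*} [CommRing A] [Algebra ℂ A] (𝒜 : ℤ → Submodule ℂ A) [GradedAlgebra 𝒜]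

theorem GradedAlgebra.proj_mem (i : ℤ) (a : A) : GradedAlgebra.proj 𝒜 i a ∈ 𝒜 i := by
  rw [GradedAlgebra.proj_apply]
  exact SetLike.coe_mem _

variable {𝒜} in
theorem GradedAlgebra.proj_of_mem {i : ℤ} {a : A} (ha : a ∈ 𝒜 i) :
    GradedAlgebra.proj 𝒜 i a = a := by
  rw [GradedAlgebra.proj_apply, decompose_of_mem_same _ ha]

variable {𝒜} in
theorem GradedAlgebra.proj_of_mem_ne {i j : ℤ} {a : A} (ha : a ∈ 𝒜 i) (h : i ≠ j) :
    GradedAlgebra.proj 𝒜 j a = 0 := by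
  rw [GradedAlgebra.proj_apply, decompose_of_mem_ne _ ha h]

theorem GradedAlgebra.eq_zero_of_proj_eq_zero {a : A} (h : ∀ i, GradedAlgebra.proj 𝒜 i a = 0) :
    a = 0 := by
  classical
  rw [← sum_support_decompose 𝒜 a]
  exact Finset.sum_eq_zero fun i _ => h i

theorem GradedAlgebra.exists_sum_proj (a : A) :
    ∃ s : Finset ℤ, (∀ i, i ∈ s ↔ GradedAlgebra.proj 𝒜 i a ≠ 0) ∧
      ∑ i ∈ s, GradedAlgebra.proj 𝒜 i a = a := by
  classical
  refine ⟨(decompose 𝒜 a).support, fun i => ?_, sum_support_decompose 𝒜 a⟩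
  rw [DFinsupp.mem_support_iff, GradedAlgebra.proj_apply, Ne, Ne, ZeroMemClass.coe_eq_zero]

theorem GradedAlgebra.proj_mul_of_mem {i : ℤ} {a : A} (ha : a ∈ 𝒜 i) (j : ℤ) (b : A) :
    GradedAlgebra.proj 𝒜 j (a * b) = a * GradedAlgebra.proj 𝒜 (j - i) b := by
  rw [GradedAlgebra.proj_apply, GradedAlgebra.proj_apply,
    ← coe_decompose_mul_add_of_left_mem 𝒜 ha, add_sub_cancel]

theorem GradedAlgebra.proj_mul_eq_zero {n k : ℤ} {a b : A}
    (ha : ∀ i < n, GradedAlgebra.proj 𝒜 i a = 0) (hb : ∀ i < k, GradedAlgebra.proj 𝒜 i b = 0)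
    {i : ℤ} (hi : i < n + k) : GradedAlgebra.proj 𝒜 i (a * b) = 0 := by
  obtain ⟨s, hs, hsum⟩ := GradedAlgebra.exists_sum_proj 𝒜 a
  rw [← hsum, Finset.sum_mul, map_sum]
  refine Finset.sum_eq_zero fun j hj => ?_
  rw [GradedAlgebra.proj_mul_of_mem 𝒜 (GradedAlgebra.proj_mem 𝒜 j a)]
  rcases lt_or_ge j n with h | h
  · rw [ha j h, zero_mul]
  · rw [hb (i - j) (by omega), mul_zero]

theorem GradedAlgebra.proj_add_mul {n k : ℤ} {a b : A}
    (ha : ∀ i < n, GradedAlgebra.proj 𝒜 i a = 0) (hb : ∀ i < k, GradedAlgebra.proj 𝒜 i b = 0) :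
    GradedAlgebra.proj 𝒜 (n + k) (a * b) =
      GradedAlgebra.proj 𝒜 n a * GradedAlgebra.proj 𝒜 k b := by
  obtain ⟨s, hs, hsum⟩ := GradedAlgebra.exists_sum_proj 𝒜 a
  conv_lhs => rw [← hsum, Finset.sum_mul, map_sum]
  rw [Finset.sum_eq_single n]
  · rw [GradedAlgebra.proj_mul_of_mem 𝒜 (GradedAlgebra.proj_mem 𝒜 n a), add_sub_cancel_left]
  · intro j _ hj
    rw [GradedAlgebra.proj_mul_of_mem 𝒜 (GradedAlgebra.proj_mem 𝒜 j a)]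
    rcases lt_or_gt_of_ne hj with h | h
    · rw [ha j h, zero_mul]
    · rw [hb _ (by omega), mul_zero]
  · intro hn
    rw [not_not.1 (mt (hs n).2 hn), zero_mul, map_zero]

open Classical in
/-- The least degree of a nonzero homogeneous component of `a`, and `⊤` for `a = 0`. -/
noncomputable def gradedOrder (a : A) : WithTop ℤ := (decompose 𝒜 a).support.min

theorem le_gradedOrder_iff {a : A} {n : ℤ} :
    (n : WithTop ℤ) ≤ gradedOrder 𝒜 a ↔ ∀ i < n, GradedAlgebra.proj 𝒜 i a = 0 := by
  classical
  rw [gradedOrder, Finset.le_min_iff]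
  simp only [DFinsupp.mem_support_iff, WithTop.coe_le_coe, GradedAlgebra.proj_apply,
    ZeroMemClass.coe_eq_zero]
  exact forall_congr' fun i => by rw [← not_imp_not, not_le, not_not]

theorem gradedOrder_eq_iff {a : A} {n : ℤ} :
    gradedOrder 𝒜 a = n ↔
      GradedAlgebra.proj 𝒜 n a ≠ 0 ∧ ∀ i < n, GradedAlgebra.proj 𝒜 i a = 0 := by
  rw [← le_gradedOrder_iff, and_comm]
  constructor
  · intro h
    refine ⟨h.ge, fun h0 => ?_⟩
    have : ((n + 1 : ℤ) : WithTop ℤ) ≤ gradedOrder 𝒜 a := by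
      rw [le_gradedOrder_iff]
      intro i hi
      rcases (Int.lt_add_one_iff.1 hi).lt_or_eq with hi | rfl
      · exact (le_gradedOrder_iff 𝒜).1 h.ge i hi
      · exact h0
    rw [h, WithTop.coe_le_coe] at this
    omega
  · rintro ⟨h, h0⟩
    refine le_antisymm ?_ h
    by_contra! hlt
    cases ho : gradedOrder 𝒜 a with
    | top =>
      have : ((n + 1 : ℤ) : WithTop ℤ) ≤ gradedOrder 𝒜 a := by rw [ho]; exact le_top
      exact h0 ((le_gradedOrder_iff 𝒜).1 this n (by omega))
    | coe k =>
      rw [ho, WithTop.coe_lt_coe] at hlt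
      exact h0 ((le_gradedOrder_iff 𝒜).1 ho.ge n hlt)

theorem gradedOrder_eq_top_iff {a : A} : gradedOrder 𝒜 a = ⊤ ↔ a = 0 := by
  classical
  rw [gradedOrder, Finset.min_eq_top, DFinsupp.support_eq_empty]
  exact (decomposeAddEquiv 𝒜).map_eq_zero_iff

theorem gradedOrder_of_mem {i : ℤ} {a : A} (ha : a ∈ 𝒜 i) (h : a ≠ 0) :
    gradedOrder 𝒜 a = i := by
  rw [gradedOrder_eq_iff, GradedAlgebra.proj_of_mem ha]
  exact ⟨h, fun j hj => GradedAlgebra.proj_of_mem_ne ha hj.ne'⟩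

theorem gradedOrder_mul [IsDomain A] (a b : A) :
    gradedOrder 𝒜 (a * b) = gradedOrder 𝒜 a + gradedOrder 𝒜 b := by
  cases ha : gradedOrder 𝒜 a with
  | top => rw [(gradedOrder_eq_top_iff 𝒜).1 ha, zero_mul, top_add, gradedOrder_eq_top_iff]
  | coe n =>
    cases hb : gradedOrder 𝒜 b with
    | top => rw [(gradedOrder_eq_top_iff 𝒜).1 hb, mul_zero, add_top, gradedOrder_eq_top_iff]
    | coe k =>
      rw [gradedOrder_eq_iff] at ha hb
      rw [← WithTop.coe_add, gradedOrder_eq_iff, GradedAlgebra.proj_add_mul 𝒜 ha.2 hb.2]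
      exact ⟨mul_ne_zero ha.1 hb.1, fun i hi => GradedAlgebra.proj_mul_eq_zero 𝒜 ha.2 hb.2 hi⟩

/-- The order with respect to a `ℤ`-grading of a domain, as a valuation. -/
noncomputable def gradedAddValuation [IsDomain A] : AddValuation A (WithTop ℤ) :=
  AddValuation.of (gradedOrder 𝒜) ((gradedOrder_eq_top_iff 𝒜).2 rfl)
    (gradedOrder_of_mem 𝒜 SetLike.GradedOne.one_mem one_ne_zero)
    (fun a b => by
      cases h : min (gradedOrder 𝒜 a) (gradedOrder 𝒜 b) with
      | top =>
        rw [min_eq_top, gradedOrder_eq_top_iff, gradedOrder_eq_top_iff] at h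
        rw [h.1, h.2, add_zero, (gradedOrder_eq_top_iff 𝒜).2 rfl]
      | coe n =>
        have h' := le_min_iff.1 h.ge
        rw [le_gradedOrder_iff] at h' ⊢
        rw [le_gradedOrder_iff] at h'
        intro i hi
        rw [map_add, h'.1 i hi, h'.2 i hi, add_zero])
    (gradedOrder_mul 𝒜)

end GradedOrder

/-! ### Homogeneous parts of derivations -/

section HomogeneousPart

open DirectSum

variable {A : Type*} [CommRing A] [Algebra ℂ A] (𝒜 : ℤ → Submodule ℂ A) [GradedAlgebra 𝒜]
  (D : Derivation ℂ A A)

namespace Derivation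

/-- The underlying linear map of the homogeneous part of degree `j` of a derivation. -/
noncomputable def homogeneousPartLinear (j : ℤ) : A →ₗ[ℂ] A :=
  toModule ℂ ℤ A (fun i => GradedAlgebra.proj 𝒜 (i + j) ∘ₗ D.toLinearMap ∘ₗ (𝒜 i).subtype) ∘ₗ
    (decomposeLinearEquiv 𝒜).toLinearMap

theorem homogeneousPartLinear_of_mem (j : ℤ) {i : ℤ} {a : A} (ha : a ∈ 𝒜 i) :
    homogeneousPartLinear 𝒜 D j a = GradedAlgebra.proj 𝒜 (i + j) (D a) := by
  have : decomposeLinearEquiv 𝒜 a = lof ℂ ℤ (fun i => 𝒜 i) i ⟨a, ha⟩ :=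
    decompose_of_mem 𝒜 ha
  simp only [homogeneousPartLinear, LinearMap.comp_apply, LinearEquiv.coe_coe, this, toModule_lof]
  rfl

/-- The homogeneous part of degree `j` of a derivation `D` of a graded algebra: it sends `a` of
degree `i` to the component of degree `i + j` of `D a`. -/
noncomputable def homogeneousPart (j : ℤ) : Derivation ℂ A A :=
  Derivation.mk' (homogeneousPartLinear 𝒜 D j) fun a b => by
    induction a using DirectSum.Decomposition.inductionOn 𝒜 with
    | zero => simp
    | add a a' ha ha' => simp only [add_mul, map_add, ha, ha', smul_eq_mul]; ring
    | @homogeneous i a =>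
      induction b using DirectSum.Decomposition.inductionOn 𝒜 with
      | zero => simp
      | add b b' hb hb' => simp only [mul_add, map_add, hb, hb', smul_eq_mul]; ring
      | @homogeneous k b =>
        rw [homogeneousPartLinear_of_mem 𝒜 D j (SetLike.GradedMul.mul_mem a.2 b.2),
          homogeneousPartLinear_of_mem 𝒜 D j a.2, homogeneousPartLinear_of_mem 𝒜 D j b.2,
          D.leibniz, map_add, smul_eq_mul, smul_eq_mul, smul_eq_mul, smul_eq_mul,
          GradedAlgebra.proj_mul_of_mem 𝒜 a.2, GradedAlgebra.proj_mul_of_mem 𝒜 b.2]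
        congr 3
        · congr 1; ring
        · congr 1; ring

variable {D} in
theorem homogeneousPart_of_mem (j : ℤ) {i : ℤ} {a : A} (ha : a ∈ 𝒜 i) :
    homogeneousPart 𝒜 D j a = GradedAlgebra.proj 𝒜 (i + j) (D a) :=
  homogeneousPartLinear_of_mem 𝒜 D j ha

variable {D} in
theorem homogeneousPart_mem (j : ℤ) {i : ℤ} {a : A} (ha : a ∈ 𝒜 i) :
    homogeneousPart 𝒜 D j a ∈ 𝒜 (i + j) := by
  rw [homogeneousPart_of_mem 𝒜 j ha]
  exact GradedAlgebra.proj_mem 𝒜 _ _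

variable {D}

theorem proj_apply_eq_sum {a : A} {s : Finset ℤ} (hsum : ∑ i ∈ s, GradedAlgebra.proj 𝒜 i a = a)
    (i : ℤ) : GradedAlgebra.proj 𝒜 i (D a) =
      ∑ j ∈ s, homogeneousPart 𝒜 D (i - j) (GradedAlgebra.proj 𝒜 j a) := by
  conv_lhs => rw [← hsum, map_sum, map_sum]
  refine Finset.sum_congr rfl fun j _ => ?_
  rw [homogeneousPart_of_mem 𝒜 _ (GradedAlgebra.proj_mem 𝒜 j a), add_sub_cancel]

theorem exists_homogeneousPart_ne_zero (hD : D ≠ 0) : ∃ j, homogeneousPart 𝒜 D j ≠ 0 := by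
  by_contra! h
  refine hD (Derivation.ext fun a => GradedAlgebra.eq_zero_of_proj_eq_zero 𝒜 fun i => ?_)
  obtain ⟨s, -, hsum⟩ := GradedAlgebra.exists_sum_proj 𝒜 a
  rw [proj_apply_eq_sum 𝒜 hsum]
  exact Finset.sum_eq_zero fun j _ => by rw [h, Derivation.zero_apply]

theorem finite_homogeneousPart_ne_zero {G : Set A} (hG : G.Finite)
    (hGtop : Algebra.adjoin ℂ G = ⊤) : {j | homogeneousPart 𝒜 D j ≠ 0}.Finite := by
  choose s hs hsum using GradedAlgebra.exists_sum_proj 𝒜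
  refine (hG.biUnion fun g _ => (s g).finite_toSet.biUnion fun i _ =>
    (s (D (GradedAlgebra.proj 𝒜 i g))).finite_toSet.image fun k => k - i).subset fun j hj => ?_
  by_contra hmem
  refine hj (Derivation.ext_of_adjoin_eq_top G hGtop fun g hg => ?_)
  rw [Derivation.zero_apply, ← hsum g, map_sum]
  refine Finset.sum_eq_zero fun i hi => ?_
  rw [homogeneousPart_of_mem 𝒜 _ (GradedAlgebra.proj_mem 𝒜 i g)]
  by_contra hne
  refine hmem (Set.mem_biUnion hg (Set.mem_biUnion hi ⟨i + j, (hs _ _).2 hne, ?_⟩))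
  exact add_sub_cancel_left i j

/-- A nonzero derivation of a finitely generated graded algebra has a homogeneous part of
lowest degree. -/
theorem exists_lowest_homogeneousPart {G : Set A} (hG : G.Finite)
    (hGtop : Algebra.adjoin ℂ G = ⊤) (hD : D ≠ 0) :
    ∃ d, homogeneousPart 𝒜 D d ≠ 0 ∧ ∀ j < d, homogeneousPart 𝒜 D j = 0 := by
  obtain ⟨d, hd, hmin⟩ := Set.exists_min_image _ id
    (finite_homogeneousPart_ne_zero 𝒜 hG hGtop (D := D)) (exists_homogeneousPart_ne_zero 𝒜 hD)
  refine ⟨d, hd, fun j hj => ?_⟩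
  by_contra hne
  exact absurd (hmin j hne) (not_le.2 hj)

variable {d : ℤ}

theorem proj_apply_eq_zero (hd : ∀ j < d, homogeneousPart 𝒜 D j = 0) {n : ℤ} {a : A}
    (ha : ∀ i < n, GradedAlgebra.proj 𝒜 i a = 0) {i : ℤ} (hi : i < n + d) :
    GradedAlgebra.proj 𝒜 i (D a) = 0 := by
  obtain ⟨s, -, hsum⟩ := GradedAlgebra.exists_sum_proj 𝒜 a
  rw [proj_apply_eq_sum 𝒜 hsum]
  refine Finset.sum_eq_zero fun j _ => ?_
  rcases lt_or_ge j n with h | h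
  · rw [ha j h, map_zero]
  · rw [hd _ (by omega), Derivation.zero_apply]

theorem proj_add_apply (hd : ∀ j < d, homogeneousPart 𝒜 D j = 0) {n : ℤ} {a : A}
    (ha : ∀ i < n, GradedAlgebra.proj 𝒜 i a = 0) :
    GradedAlgebra.proj 𝒜 (n + d) (D a) =
      homogeneousPart 𝒜 D d (GradedAlgebra.proj 𝒜 n a) := by
  obtain ⟨s, hs, hsum⟩ := GradedAlgebra.exists_sum_proj 𝒜 a
  rw [proj_apply_eq_sum 𝒜 hsum, Finset.sum_eq_single n]
  · rw [add_sub_cancel_left]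
  · intro j _ hj
    rcases lt_or_gt_of_ne hj with h | h
    · rw [ha j h, map_zero]
    · rw [hd _ (by omega), Derivation.zero_apply]
  · intro hn
    rw [not_not.1 (mt (hs n).2 hn), map_zero]

theorem proj_iterate (hd : ∀ j < d, homogeneousPart 𝒜 D j = 0) {n : ℤ} {a : A}
    (ha : ∀ i < n, GradedAlgebra.proj 𝒜 i a = 0) (N : ℕ) :
    (∀ i < n + N * d, GradedAlgebra.proj 𝒜 i (D^[N] a) = 0) ∧
      GradedAlgebra.proj 𝒜 (n + N * d) (D^[N] a) =
        (homogeneousPart 𝒜 D d)^[N] (GradedAlgebra.proj 𝒜 n a) := by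
  induction N with
  | zero => simpa using ha
  | succ N ih =>
    have e : n + ((N + 1 : ℕ) : ℤ) * d = n + N * d + d := by push_cast; ring
    rw [e, Function.iterate_succ_apply', Function.iterate_succ_apply']
    exact ⟨fun i hi => proj_apply_eq_zero 𝒜 hd ih.1 hi, by rw [proj_add_apply 𝒜 hd ih.1, ih.2]⟩

/-- The homogeneous part of lowest degree of a locally nilpotent derivation is locally
nilpotent. -/
theorem isLocallyNilpotent_homogeneousPart (hD : IsLocallyNilpotentDerivation D)
    (hd : ∀ j < d, homogeneousPart 𝒜 D j = 0) :
    IsLocallyNilpotentDerivation (homogeneousPart 𝒜 D d) := by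
  intro a
  induction a using DirectSum.Decomposition.inductionOn 𝒜 with
  | zero => exact ⟨0, rfl⟩
  | add a b ha hb => exact Derivation.exists_iterate_add_eq_zero ha hb
  | @homogeneous i a =>
    obtain ⟨N, hN⟩ := hD a
    refine ⟨N, ?_⟩
    have := (proj_iterate 𝒜 hd
      (fun j hj => GradedAlgebra.proj_of_mem_ne a.2 hj.ne') N).2
    rw [GradedAlgebra.proj_of_mem a.2, hN, map_zero] at this
    exact this.symm

end Derivation
end HomogeneousPart

/-! ### A consequence of the Mason–Stothers theorem -/

section Mason

open Polynomial UniqueFactorizationMonoid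

variable {F : Type*} [Field F]

theorem Polynomial.natDegree_one_add_mul_pow_le (m : ℕ) (a b w : F) :
    (1 + C w * (C a + C b * X) ^ m).natDegree ≤ m := by
  refine (natDegree_add_le _ _).trans (max_le (by simp) ((natDegree_C_mul_le _ _).trans ?_))
  refine (natDegree_pow_le_of_le (m := 1) m ?_).trans (by omega)
  exact (natDegree_add_le _ _).trans (max_le (by simp) ((natDegree_C_mul_le _ _).trans natDegree_X_le))

variable [CharZero F]

/-- If `X = x z + 1` and `Y = y z + 1` are not constant, then the Mason–Stothers inequality for
`Y ^ l - X ^ k = z L` bounds `k * deg X` and `l * deg Y` by `deg X + deg Y + deg z + m - 1`, where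
`deg z ≤ deg X` and `deg z ≤ deg Y`. Since `m` divides the degrees, the term `m - 1` can be dropped
after collecting terms, and `k ≥ 4`, `l ≥ 3` leaves only degree zero. -/
theorem Polynomial.natDegree_eq_zero_of_mason {k l m : ℕ} (hk : 4 ≤ k) (hl : 3 ≤ l) (hm : 1 ≤ m)
    {x y z L : F[X]} (hx : x ≠ 0) (hy : y ≠ 0) (hz : z ≠ 0) (hX : x * z + 1 ≠ 0)
    (hY : y * z + 1 ≠ 0) (hL : Squarefree L) (hLm : L.natDegree ≤ m)
    (hmX : m ∣ (x * z + 1).natDegree) (hmY : m ∣ (y * z + 1).natDegree)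
    (h : (y * z + 1) ^ l - (x * z + 1) ^ k = z * L) :
    (x * z + 1).natDegree = 0 ∧ (y * z + 1).natDegree = 0 := by
  classical
  set P := x * z + 1 with hP
  set Q := y * z + 1 with hQ
  -- The square of a common prime factor divides `z * L`, and is prime to `z`.
  have hcop : IsCoprime P Q := by
    refine isCoprime_of_irreducible_dvd (fun h => hX h.1) fun π hπ hπP hπQ => ?_
    have hπz : IsCoprime (π * π) z := by
      have : IsCoprime π z := by
        obtain ⟨c, hc⟩ := hπP
        exact ⟨c, -x, by rw [mul_comm, ← hc]; ring⟩
      exact this.mul_left this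
    have hdvd : π * π ∣ z * L := by
      rw [← h, ← pow_two]
      exact dvd_sub ((pow_dvd_pow _ (by omega)).trans (pow_dvd_pow_of_dvd hπQ l))
        ((pow_dvd_pow _ (by omega)).trans (pow_dvd_pow_of_dvd hπP k))
    exact hπ.not_isUnit (hL π (hπz.dvd_of_dvd_mul_left hdvd))
  have hdP : P.natDegree = x.natDegree + z.natDegree := by
    rw [hP, ← C_1, natDegree_add_C, natDegree_mul hx hz]
  have hdQ : Q.natDegree = y.natDegree + z.natDegree := by
    rw [hQ, ← C_1, natDegree_add_C, natDegree_mul hy hz]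
  have hL0 : L ≠ 0 := hL.ne_zero
  have hPk : P ^ k ≠ 0 := pow_ne_zero _ hX
  have hQl : -Q ^ l ≠ 0 := neg_ne_zero.2 (pow_ne_zero _ hY)
  have hzL : z * L ≠ 0 := mul_ne_zero hz hL0
  have hrad : (radical (P ^ k * -Q ^ l * (z * L))).natDegree ≤
      P.natDegree + Q.natDegree + z.natDegree + m := by
    have hle : radical (P ^ k * -Q ^ l * (z * L)) ∣ P * Q * (z * L) := by
      rw [← exists_dvd_pow_iff_radical_dvd (mul_ne_zero (mul_ne_zero hPk hQl) hzL)]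
      refine ⟨k + l, ?_⟩
      rw [mul_pow, mul_pow]
      refine mul_dvd_mul (mul_dvd_mul ?_ ?_) ?_
      · exact pow_dvd_pow _ (by omega)
      · exact (neg_dvd.2 dvd_rfl).trans (pow_dvd_pow _ (by omega))
      · exact dvd_pow_self _ (by omega)
    refine (natDegree_le_of_dvd hle (by simp_all)).trans ?_
    rw [natDegree_mul (by simp_all) (by simp_all), natDegree_mul hX hY, natDegree_mul hz hL0]
    omega
  rcases Polynomial.abc hPk hQl hzL ((hcop.pow).neg_right) (by rw [← h]; ring) with hd | hd
  · rw [natDegree_neg, natDegree_pow, natDegree_pow] at hd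
    obtain ⟨a, ha⟩ := hmX
    obtain ⟨b, hb⟩ := hmY
    obtain ⟨h1, h2, -⟩ := hd
    have hk' : 4 * P.natDegree ≤ k * P.natDegree := Nat.mul_le_mul_right _ hk
    have hl' : 3 * Q.natDegree ≤ l * Q.natDegree := Nat.mul_le_mul_right _ hl
    -- In units of `m`, the inequalities become `2 a ≤ b` and `b ≤ a`.
    have e1 : 2 * (m * a) < m * b + m := by omega
    have e2 : m * b < m * a + m := by omega
    have e3 : 2 * a < b + 1 := by nlinarith
    have e4 : b < a + 1 := by nlinarith
    have ha0 : a = 0 := by omega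
    have hb0 : b = 0 := by omega
    simp [ha, hb, ha0, hb0]
  · obtain ⟨h1, h2, -⟩ := hd
    rw [derivative_neg, neg_eq_zero] at h2
    have h1' := derivative_eq_zero.1 h1
    have h2' := derivative_eq_zero.1 h2
    rw [natDegree_pow] at h1' h2'
    constructor
    · exact (Nat.mul_eq_zero.1 h1').resolve_left (by omega)
    · exact (Nat.mul_eq_zero.1 h2').resolve_left (by omega)

theorem Polynomial.squarefree_one_add_mul_pow {m : ℕ} (hm : m ≠ 0) {a b w : F}
    (h : b = 0 → 1 + w * a ^ m ≠ 0) :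
    Squarefree (1 + C w * (C a + C b * X) ^ m) := by
  refine Separable.squarefree ?_
  by_cases hb : b = 0
  · have : 1 + C w * (C a + C b * X) ^ m = C (1 + w * a ^ m) := by simp [hb]
    rw [this, separable_C, isUnit_iff_ne_zero]
    exact h hb
  · obtain ⟨n, rfl⟩ := Nat.exists_eq_succ_of_ne_zero hm
    have hc : ((n + 1 : ℕ) : F) * b ≠ 0 := mul_ne_zero (Nat.cast_ne_zero.2 (by omega)) hb
    have hder : derivative (1 + C w * (C a + C b * X) ^ (n + 1)) =
        C w * (C (((n + 1 : ℕ) : F) * b) * (C a + C b * X) ^ n) := by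
      rw [derivative_add, derivative_one, derivative_C_mul, derivative_pow]
      simp only [derivative_add, derivative_C, derivative_mul, derivative_X, C_mul,
        Nat.add_sub_cancel]
      ring
    rw [separable_def]
    refine ⟨1, -(C a + C b * X) * C (((n + 1 : ℕ) : F) * b)⁻¹, ?_⟩
    have : C (((n + 1 : ℕ) : F) * b)⁻¹ * C (((n + 1 : ℕ) : F) * b) = 1 := by
      rw [← C_mul, inv_mul_cancel₀ hc, C_1]
    rw [Nat.succ_eq_add_one, hder]
    linear_combination (-C w * (C a + C b * X) ^ (n + 1)) * this

end Mason

/-! ### Kernel elements of negative order -/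

section NegativeOrder

open DirectSum
open scoped Nat

variable {A : Type*} [CommRing A] [Algebra ℂ A] [IsDomain A]
  (𝒜 : ℤ → Submodule ℂ A) [GradedAlgebra 𝒜] {D : Derivation ℂ A A}

/-- Division by a local slice `s`: up to a kernel factor, an element of degree `n` with respect to
`D` is a kernel multiple of `s ^ n` plus an element of smaller degree. -/
theorem IsLocallyNilpotentDerivation.exists_eq_mul_slice_pow_add
    (hD : IsLocallyNilpotentDerivation D) {s : A} (hs : D s ≠ 0) (hDs : D (D s) = 0) {a : A}
    (ha : a ≠ 0) : ∃ b c r : A, b ≠ 0 ∧ D b = 0 ∧ c ≠ 0 ∧ D c = 0 ∧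
      b * a = c * s ^ (hD.expHom a).natDegree + r ∧
      (r ≠ 0 → (hD.expHom r).natDegree < (hD.expHom a).natDegree) := by
  set n := (hD.expHom a).natDegree with hn
  have hc : D (D^[n] a) = 0 := hD.apply_iterate_natDegree a
  have hb : D ((n ! : A) * D s ^ n) = 0 := by simp [Derivation.leibniz_pow, hDs]
  have : CharZero A := charZero_of_injective_algebraMap (algebraMap ℂ A).injective
  refine ⟨(n ! : A) * D s ^ n, D^[n] a, (n ! : A) * D s ^ n * a - D^[n] a * s ^ n,
    mul_ne_zero (Nat.cast_ne_zero.2 n.factorial_ne_zero) (pow_ne_zero _ hs), hb,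
    hD.iterate_natDegree_ne_zero ha, hc, by ring, fun hr => ?_⟩
  refine hD.natDegree_lt_of_iterate_eq_zero hr ?_
  rw [iterate_map_sub, Derivation.iterate_mul_left_of_apply_eq_zero hb,
    Derivation.iterate_mul_left_of_apply_eq_zero hc,
    Derivation.iterate_pow_of_iterate_two_eq_zero hDs]
  ring

/-- If all homogeneous elements of positive degree are divisible by `u`, and `D u ≠ 0`, then the
kernel of `D` contains an element of negative order. Otherwise all of its nonzero elements have
order zero, so that the order of any element is controlled by its degree with respect to `D` and by
the order of a local slice; this contradicts the order of `u` or that of `v`. -/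
theorem IsLocallyNilpotentDerivation.exists_gradedOrder_neg (hD : IsLocallyNilpotentDerivation D)
    {u v : A} {e f : ℤ} (he : 0 < e) (hu : u ∈ 𝒜 e) (hf : f < 0) (hv : v ∈ 𝒜 f) (hv0 : v ≠ 0)
    (hDu : D u ≠ 0) (hdvd : ∀ i > 0, ∀ a ∈ 𝒜 i, u ∣ a) :
    ∃ c, D c = 0 ∧ ∃ n : ℤ, n < 0 ∧ gradedOrder 𝒜 c = n := by
  by_contra! hcon
  have hu0 : u ≠ 0 := fun h => hDu (by rw [h, map_zero])
  let O := gradedAddValuation 𝒜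
  have hO : ∀ a, O a = gradedOrder 𝒜 a := fun a => rfl
  have hOu : O u = e := gradedOrder_of_mem 𝒜 hu hu0
  have hOv : O v = f := gradedOrder_of_mem 𝒜 hv hv0
  have hker : ∀ c, c ≠ 0 → D c = 0 → O c = 0 := by
    intro c hc hDc
    cases hn : O c with
    | top => exact absurd ((gradedOrder_eq_top_iff 𝒜).1 hn) hc
    | coe n =>
      rcases lt_trichotomy n 0 with h | rfl | h
      · exact absurd hn (hcon c hDc n h)
      · rfl
      · refine absurd (hD.apply_eq_zero_of_dvd ?_ hc hDc) hDu
        obtain ⟨s, hs, hsum⟩ := GradedAlgebra.exists_sum_proj 𝒜 c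
        rw [← hsum]
        refine Finset.dvd_sum fun i hi => hdvd i ?_ _ (GradedAlgebra.proj_mem 𝒜 i c)
        by_contra hi0
        exact (hs i).1 hi (((gradedOrder_eq_iff 𝒜).1 hn).2 i (by omega))
  set s := D^[(hD.expHom u).natDegree - 1] u with hs_def
  have hs : D s = D^[(hD.expHom u).natDegree] u := hD.apply_iterate_natDegree_sub_one hDu
  have hDs0 : D s ≠ 0 := hs ▸ hD.iterate_natDegree_ne_zero hu0
  have hDDs : D (D s) = 0 := hs ▸ hD.apply_iterate_natDegree u
  cases hσ : O s with
  | top =>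
    rw [(gradedOrder_eq_top_iff 𝒜).1 hσ, map_zero] at hDs0
    exact hDs0 rfl
  | coe σ =>
    have hpow : ∀ (c : A) (n : ℕ), c ≠ 0 → D c = 0 → O (c * s ^ n) = ((n * σ : ℤ) : WithTop ℤ) := by
      intro c n hc hDc
      rw [O.map_mul, O.map_pow, hker c hc hDc, hσ, zero_add, ← WithTop.coe_nsmul, nsmul_eq_mul]
    -- If the slice has negative order, all orders are at most zero, contrary to that of `u`;
    -- otherwise all orders are at least zero, contrary to that of `v`.
    rcases lt_or_ge σ 0 with hneg | hpos
    · have key : ∀ (n : ℕ) (a : A), a ≠ 0 → (hD.expHom a).natDegree = n →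
          O a = ((n * σ : ℤ) : WithTop ℤ) := by
        intro n
        induction n using Nat.strong_induction_on with
        | _ n ih =>
          intro a ha hn
          obtain ⟨b, c, r, hb, hDb, hc, hDc, hba, hr⟩ :=
            hD.exists_eq_mul_slice_pow_add hDs0 hDDs ha
          rw [hn] at hba hr
          rw [← zero_add (O a), ← hker b hb hDb, ← O.map_mul, hba, ← hpow c n hc hDc]
          by_cases hr0 : r = 0
          · rw [hr0, add_zero]
          · refine O.map_add_eq_of_lt_left ?_
            rw [hpow c n hc hDc, ih _ (hr hr0) r hr0 rfl, WithTop.coe_lt_coe]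
            exact mul_lt_mul_of_neg_right (by exact_mod_cast hr hr0) hneg
      have h := key _ u hu0 rfl
      rw [hOu, WithTop.coe_inj] at h
      have := mul_nonpos_of_nonneg_of_nonpos
        (Nat.cast_nonneg (α := ℤ) (hD.expHom u).natDegree) hneg.le
      omega
    · have key : ∀ (n : ℕ) (a : A), a ≠ 0 → (hD.expHom a).natDegree = n → 0 ≤ O a := by
        intro n
        induction n using Nat.strong_induction_on with
        | _ n ih =>
          intro a ha hn
          obtain ⟨b, c, r, hb, hDb, hc, hDc, hba, hr⟩ :=
            hD.exists_eq_mul_slice_pow_add hDs0 hDDs ha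
          rw [hn] at hba hr
          have hOa : O a = O (b * a) := by rw [O.map_mul, hker b hb hDb, zero_add]
          rw [hOa, hba]
          refine O.map_le_add ?_ ?_
          · rw [hpow c n hc hDc]
            exact WithTop.coe_le_coe.2 (by positivity)
          · by_cases hr0 : r = 0
            · rw [hr0, O.map_zero]; exact le_top
            · exact ih _ (hr hr0) r hr0 rfl
      have h := key _ v hv0 rfl
      rw [hOv] at h
      exact absurd (WithTop.coe_le_coe.1 h) (not_le.2 hf)

end NegativeOrder

/-! ### Homogeneous locally nilpotent derivations -/

section HomogeneousDerivation

variable {A : Type*} [CommRing A] [Algebra ℂ A]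
  (𝒜 : ℤ → Submodule ℂ A) {D : Derivation ℂ A A} {d m : ℤ} {u : A}

theorem Derivation.iterate_mem_of_homogeneous (hdeg : ∀ i, ∀ a ∈ 𝒜 i, D a ∈ 𝒜 (i + d)) (N : ℕ)
    {i : ℤ} {a : A} (ha : a ∈ 𝒜 i) : D^[N] a ∈ 𝒜 (i + N * d) := by
  induction N with
  | zero => simpa using ha
  | succ N ih =>
    rw [Function.iterate_succ_apply',
      show i + ((N + 1 : ℕ) : ℤ) * d = i + N * d + d by push_cast; ring]
    exact hdeg _ _ ih

variable [IsDomain A]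

/-- The last nonzero iterate of `D` on `a` is homogeneous of degree `i + deg a * d`. If that were
not a multiple of `m`, it would be a multiple of `u`, which lies outside the factorially closed
kernel. -/
theorem IsLocallyNilpotentDerivation.dvd_add_natDegree_mul (hD : IsLocallyNilpotentDerivation D)
    (hdeg : ∀ i, ∀ a ∈ 𝒜 i, D a ∈ 𝒜 (i + d)) (hDu : D u ≠ 0)
    (hdvd : ∀ i, ¬ m ∣ i → ∀ a ∈ 𝒜 i, u ∣ a) {i : ℤ} {a : A} (ha : a ∈ 𝒜 i) (ha0 : a ≠ 0) :
    m ∣ i + (hD.expHom a).natDegree * d := by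
  by_contra h
  exact hDu (hD.apply_eq_zero_of_dvd
    (hdvd _ h _ (D.iterate_mem_of_homogeneous 𝒜 hdeg _ ha))
    (hD.iterate_natDegree_ne_zero ha0) (hD.apply_iterate_natDegree a))

/-- The degree `d` of `D` is coprime to `m`, by `dvd_add_natDegree_mul` for `u`. -/
theorem IsLocallyNilpotentDerivation.dvd_natDegree (hD : IsLocallyNilpotentDerivation D)
    (hdeg : ∀ i, ∀ a ∈ 𝒜 i, D a ∈ 𝒜 (i + d)) (hu : u ∈ 𝒜 1) (hDu : D u ≠ 0)
    (hdvd : ∀ i, ¬ m ∣ i → ∀ a ∈ 𝒜 i, u ∣ a) {a : A} (ha : a ∈ 𝒜 0) (ha0 : a ≠ 0) :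
    m ∣ (hD.expHom a).natDegree := by
  have hu0 : u ≠ 0 := fun h => hDu (by rw [h, map_zero])
  have h1 := hD.dvd_add_natDegree_mul 𝒜 hdeg hDu hdvd hu hu0
  have h2 := hD.dvd_add_natDegree_mul 𝒜 hdeg hDu hdvd ha ha0
  rw [zero_add] at h2
  have hcop : IsCoprime m d := by
    obtain ⟨c, hc⟩ := h1
    exact ⟨c, -(hD.expHom u).natDegree, by linear_combination -hc⟩
  exact hcop.dvd_of_dvd_mul_right h2

/-- The degree of the local slice obtained from `u` is not a multiple of `m`, so `u` divides it.
The exponential of a slice has degree one in `t`, and so has that of its divisor `u`. -/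
theorem IsLocallyNilpotentDerivation.natDegree_le_one (hD : IsLocallyNilpotentDerivation D)
    (hdeg : ∀ i, ∀ a ∈ 𝒜 i, D a ∈ 𝒜 (i + d)) (hu : u ∈ 𝒜 1) (hDu : D u ≠ 0)
    (hdvd : ∀ i, ¬ m ∣ i → ∀ a ∈ 𝒜 i, u ∣ a) (hm : 2 ≤ m) : (hD.expHom u).natDegree ≤ 1 := by
  have hu0 : u ≠ 0 := fun h => hDu (by rw [h, map_zero])
  have h1 := hD.dvd_add_natDegree_mul 𝒜 hdeg hDu hdvd hu hu0
  set n := (hD.expHom u).natDegree with hn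
  have hn0 : n ≠ 0 := mt (hD.natDegree_expHom_eq_zero_iff u).1 hDu
  set s := D^[n - 1] u with hs_def
  have hs : D s = D^[n] u := hD.apply_iterate_natDegree_sub_one hDu
  have hDs0 : D s ≠ 0 := hs ▸ hD.iterate_natDegree_ne_zero hu0
  have hDDs : D (D s) = 0 := hs ▸ hD.apply_iterate_natDegree u
  have hs0 : s ≠ 0 := fun h => hDs0 (by rw [h, map_zero])
  have hus : u ∣ s := by
    refine hdvd _ (fun h => ?_) s (D.iterate_mem_of_homogeneous 𝒜 hdeg (n - 1) hu)
    rw [Nat.cast_sub (by omega), Nat.cast_one] at h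
    have hd : m ∣ d := by
      have := dvd_sub h1 h
      rwa [show 1 + (n : ℤ) * d - (1 + ((n : ℤ) - 1) * d) = d by ring] at this
    have := dvd_sub h1 (hd.mul_left n)
    rw [add_sub_cancel_right] at this
    have := Int.le_of_dvd one_pos this
    omega
  obtain ⟨w, hw⟩ := hus
  have hw0 : w ≠ 0 := fun h => hs0 (by rw [hw, h, mul_zero])
  have h2 := hD.natDegree_expHom_mul hu0 hw0
  rw [← hw] at h2
  have h3 : (hD.expHom s).natDegree < 2 := hD.natDegree_lt_of_iterate_eq_zero hs0 hDDs
  omega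

end HomogeneousDerivation

/-! ### Derivations of `u ^ m * v + q = 0` -/

section Hypersurface

open Polynomial MiyanishiHypersurface

variable {A : Type*} [CommRing A] [Algebra ℂ A] {D : Derivation ℂ A A} {k l m : ℕ} {x y z u v : A}

theorem Derivation.apply_q_eq_zero (hx : D x = 0) (hy : D y = 0) (hz : D z = 0) :
    D (q k l x y z) = 0 := by
  simp [q, Derivation.leibniz_pow, hx, hy, hz]

variable [IsDomain A] (𝒜 : ℤ → Submodule ℂ A) [GradedAlgebra 𝒜]

theorem IsLocallyNilpotentDerivation.apply_eq_zero_of_apply_mul_add_one_eq_zero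
    (hD : IsLocallyNilpotentDerivation D) (hx0 : x ≠ 0) (hz0 : z ≠ 0) (h : D (x * z + 1) = 0) :
    D x = 0 ∧ D z = 0 := by
  have h' : D (x * z) = 0 := by simpa using h
  exact ⟨hD.apply_eq_zero_of_dvd (dvd_mul_right _ _) (mul_ne_zero hx0 hz0) h',
    hD.apply_eq_zero_of_dvd (dvd_mul_left _ _) (mul_ne_zero hx0 hz0) h'⟩

/-- The orbits of a homogeneous locally nilpotent derivation that annihilates `v` are constant, by
the Mason–Stothers theorem applied to the restrictions of `xz + 1` and `yz + 1` to the generic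
orbit. -/
theorem IsLocallyNilpotentDerivation.eq_zero_of_homogeneous (hD : IsLocallyNilpotentDerivation D)
    {d : ℤ} (hdeg : ∀ i, ∀ a ∈ 𝒜 i, D a ∈ 𝒜 (i + d)) (hm : 2 ≤ m) (hl : 3 ≤ l) (hkl : l < k)
    (hgen : Algebra.adjoin ℂ {x, y, z, u, v} = ⊤)
    (hx : x ∈ 𝒜 0) (hy : y ∈ 𝒜 0) (hz : z ∈ 𝒜 0) (hu : u ∈ 𝒜 1)
    (hx0 : x ≠ 0) (hy0 : y ≠ 0) (hz0 : z ≠ 0) (hX0 : x * z + 1 ≠ 0) (hY0 : y * z + 1 ≠ 0)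
    (hu0 : u ≠ 0) (hv0 : v ≠ 0) (hL0 : 1 + v * u ^ m ≠ 0)
    (hrel : u ^ m * v + q k l x y z = 0)
    (hdvd : ∀ i, ¬ (m : ℤ) ∣ i → ∀ a ∈ 𝒜 i, u ∣ a) (hDv : D v = 0) : D = 0 := by
  let F := FractionRing A
  have : CharZero A := charZero_of_injective_algebraMap (algebraMap ℂ A).injective
  have : CharZero F := charZero_of_injective_algebraMap (IsFractionRing.injective A F)
  have hinj : Function.Injective (algebraMap A F) := IsFractionRing.injective A F
  let ψ : A →+* F[X] := (mapRingHom (algebraMap A F)).comp hD.expHom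
  have hψ0 : ∀ {a}, a ≠ 0 → ψ a ≠ 0 := fun ha =>
    (map_ne_zero_iff ψ ((map_injective _ hinj).comp hD.expHom_injective)).2 ha
  have hψdeg : ∀ a, (ψ a).natDegree = (hD.expHom a).natDegree := fun a =>
    natDegree_map_eq_of_injective hinj _
  have hone : (1 : A) ∈ 𝒜 0 := SetLike.GradedOne.one_mem
  have hX : x * z + 1 ∈ 𝒜 0 := add_mem (by simpa using SetLike.GradedMul.mul_mem hx hz) hone
  have hY : y * z + 1 ∈ 𝒜 0 := add_mem (by simpa using SetLike.GradedMul.mul_mem hy hz) hone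
  have hu1 : (hD.expHom u).natDegree ≤ 1 := by
    by_cases hDu : D u = 0
    · rw [(hD.natDegree_expHom_eq_zero_iff u).2 hDu]
      exact zero_le_one
    · exact hD.natDegree_le_one 𝒜 hdeg hu hDu hdvd (by exact_mod_cast hm)
  have hψu : ψ u = C (algebraMap A F u) + C (algebraMap A F (D u)) * X := by
    have : hD.expHom u = C (D u) * X + C u := by
      rw [eq_X_add_C_of_natDegree_le_one hu1, hD.coeff_expHom, hD.coeff_expHom]
      simp
    simp only [ψ, RingHom.comp_apply, this]
    simp [add_comm]
  have hψv : ψ v = C (algebraMap A F v) := by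
    simp [ψ, hD.expHom_of_apply_eq_zero hDv]
  have hψL : ψ (1 + v * u ^ m) = 1 + C (algebraMap A F v) *
      (C (algebraMap A F u) + C (algebraMap A F (D u)) * X) ^ m := by
    simp [hψu, hψv]
  have hL : Squarefree (ψ (1 + v * u ^ m)) := by
    rw [hψL]
    refine squarefree_one_add_mul_pow (by omega) fun _ => ?_
    have := (map_ne_zero_iff _ hinj).2 hL0
    simpa using this
  have heq : (ψ y * ψ z + 1) ^ l - (ψ x * ψ z + 1) ^ k = ψ z * ψ (1 + v * u ^ m) := by
    have h : (y * z + 1) ^ l - (x * z + 1) ^ k = z * (1 + v * u ^ m) := by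
      linear_combination (-z) * hrel + mul_q k l x y z
    simpa using congrArg ψ h
  have hψX : ψ x * ψ z + 1 = ψ (x * z + 1) := by simp
  have hψY : ψ y * ψ z + 1 = ψ (y * z + 1) := by simp
  -- All degrees are multiples of `μ`, and the degree of `1 + v * u ^ m` is at most `μ`.
  obtain ⟨μ, hμ, hμL, hμX, hμY⟩ : ∃ μ : ℕ, 1 ≤ μ ∧ (ψ (1 + v * u ^ m)).natDegree ≤ μ ∧
      μ ∣ (ψ (x * z + 1)).natDegree ∧ μ ∣ (ψ (y * z + 1)).natDegree := by
    by_cases hDu : D u = 0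
    · refine ⟨1, le_rfl, ?_, one_dvd _, one_dvd _⟩
      rw [hψdeg, (hD.natDegree_expHom_eq_zero_iff _).2 (by
        simp [Derivation.leibniz_pow, hDu, hDv])]
      exact zero_le_one
    · refine ⟨m, by omega, ?_, ?_, ?_⟩
      · rw [hψL]
        exact natDegree_one_add_mul_pow_le m _ _ _
      · rw [hψdeg]
        exact_mod_cast hD.dvd_natDegree 𝒜 hdeg hu hDu hdvd hX hX0
      · rw [hψdeg]
        exact_mod_cast hD.dvd_natDegree 𝒜 hdeg hu hDu hdvd hY hY0
  have hconst := natDegree_eq_zero_of_mason (by omega : 4 ≤ k) hl hμ (hψ0 hx0) (hψ0 hy0) (hψ0 hz0)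
    (hψX ▸ hψ0 hX0) (hψY ▸ hψ0 hY0) hL hμL (hψX ▸ hμX) (hψY ▸ hμY) heq
  rw [hψX, hψY, hψdeg, hψdeg, hD.natDegree_expHom_eq_zero_iff,
    hD.natDegree_expHom_eq_zero_iff] at hconst
  obtain ⟨hDx, hDz⟩ := hD.apply_eq_zero_of_apply_mul_add_one_eq_zero hx0 hz0 hconst.1
  obtain ⟨hDy, -⟩ := hD.apply_eq_zero_of_apply_mul_add_one_eq_zero hy0 hz0 hconst.2
  have hDu : D u = 0 := by
    refine hD.apply_eq_zero_of_dvd ((dvd_pow_self u (by omega : m ≠ 0)).mul_right v)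
      (mul_ne_zero (pow_ne_zero _ hu0) hv0) ?_
    rw [eq_neg_of_add_eq_zero_left hrel, map_neg, D.apply_q_eq_zero hDx hDy hDz, neg_zero]
  refine Derivation.ext_of_adjoin_eq_top _ hgen ?_
  rintro a (rfl | rfl | rfl | rfl | rfl) <;> simpa

/-- The homogeneous part of lowest degree of a locally nilpotent derivation with `D u ≠ 0` would be
nonzero and annihilate `v`. -/
theorem IsLocallyNilpotentDerivation.apply_eq_zero_of_graded (hD : IsLocallyNilpotentDerivation D)
    (hm : 2 ≤ m) (hl : 3 ≤ l) (hkl : l < k) (hgen : Algebra.adjoin ℂ {x, y, z, u, v} = ⊤)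
    (hx : x ∈ 𝒜 0) (hy : y ∈ 𝒜 0) (hz : z ∈ 𝒜 0) (hu : u ∈ 𝒜 1) (hv : v ∈ 𝒜 (-m))
    (hx0 : x ≠ 0) (hy0 : y ≠ 0) (hz0 : z ≠ 0) (hX0 : x * z + 1 ≠ 0) (hY0 : y * z + 1 ≠ 0)
    (hu0 : u ≠ 0) (hv0 : v ≠ 0) (hL0 : 1 + v * u ^ m ≠ 0)
    (hrel : u ^ m * v + q k l x y z = 0) (hpos : ∀ i > 0, ∀ a ∈ 𝒜 i, u ∣ a)
    (hneg : ∀ i < 0, ∀ a ∈ 𝒜 i, v ∣ a)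
    (hdvd : ∀ i, ¬ (m : ℤ) ∣ i → ∀ a ∈ 𝒜 i, u ∣ a) : D u = 0 := by
  by_contra hDu
  obtain ⟨c, hDc, n, hn, hc⟩ :=
    hD.exists_gradedOrder_neg 𝒜 one_pos hu (by omega) hv hv0 hDu hpos
  rw [gradedOrder_eq_iff] at hc
  obtain ⟨d, hd0, hd⟩ := Derivation.exists_lowest_homogeneousPart 𝒜 (D := D)
    (Set.toFinite {x, y, z, u, v}) hgen (fun h => hDu (by rw [h, Derivation.zero_apply]))
  have hE := Derivation.isLocallyNilpotent_homogeneousPart 𝒜 hD hd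
  have hEv : Derivation.homogeneousPart 𝒜 D d v = 0 := by
    refine hE.apply_eq_zero_of_dvd (hneg n hn _ (GradedAlgebra.proj_mem 𝒜 n c)) hc.1 ?_
    rw [← Derivation.proj_add_apply 𝒜 hd hc.2, hDc, map_zero]
  exact hd0 (hE.eq_zero_of_homogeneous 𝒜
    (fun i a ha => Derivation.homogeneousPart_mem 𝒜 d ha) hm hl hkl hgen hx hy hz hu hx0 hy0 hz0
    hX0 hY0 hu0 hv0 hL0 hrel hdvd hEv)

end Hypersurface

/-! ### Regular functions and regular maps -/

section RegularFunctions

open MvPolynomial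

variable {σ τ : Type*} {X : Set (σ → ℂ)} {Y : Set (τ → ℂ)}

theorem regularFunctions.aeval_apply (F : τ → regularFunctions X) (p : MvPolynomial τ ℂ) (a : X) :
    (aeval F p).1 a = eval (fun j => (F j).1 a) p := by
  induction p using MvPolynomial.induction_on with
  | C c => rw [aeval_C, eval_C]; rfl
  | add p q hp hq => rw [map_add, map_add, ← hp, ← hq]; rfl
  | mul_X p i hp => rw [map_mul, map_mul, aeval_X, eval_X, ← hp]; rfl

variable (X) in
/-- The restriction of polynomials to a closed subset of affine space. -/
noncomputable def regularFunctions.restrict : MvPolynomial σ ℂ →ₐ[ℂ] regularFunctions X :=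
  aeval (coordFunction X)

theorem regularFunctions.restrict_apply (p : MvPolynomial σ ℂ) (a : X) :
    (restrict X p).1 a = eval a.1 p :=
  regularFunctions.aeval_apply _ p a

variable (X) in
theorem regularFunctions.restrict_surjective : Function.Surjective (restrict X) := by
  intro f
  obtain ⟨p, hp⟩ := f.2
  refine ⟨p, Subtype.ext (funext fun a => ?_)⟩
  rw [restrict_apply]
  exact (hp a).symm

variable (X) in
theorem regularFunctions.adjoin_range_coordFunction :
    Algebra.adjoin ℂ (Set.range (coordFunction X)) = ⊤ := by
  rw [Algebra.adjoin_range_eq_range_aeval]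
  exact AlgHom.range_eq_top _ |>.2 (restrict_surjective X)

theorem IsRegularMap.comp_mem {f : X → Y} (hf : IsRegularMap f) (g : regularFunctions Y) :
    (fun a => g.1 (f a)) ∈ regularFunctions X := by
  obtain ⟨g, p, hp⟩ := g
  have h := (aeval (fun j => (⟨fun a => (f a).1 j, hf j⟩ : regularFunctions X)) p).2
  convert h using 1
  funext a
  rw [regularFunctions.aeval_apply]
  exact hp (f a)

/-- Biregularly isomorphic closed subsets have isomorphic algebras of regular functions. -/
theorem BiregularlyIsomorphic.nonempty_algEquiv (h : BiregularlyIsomorphic X Y) :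
    Nonempty (regularFunctions X ≃ₐ[ℂ] regularFunctions Y) := by
  obtain ⟨e, he, he'⟩ := h
  exact ⟨{
    toFun := fun g => ⟨fun b => g.1 (e.symm b), he'.comp_mem g⟩
    invFun := fun g => ⟨fun a => g.1 (e a), he.comp_mem g⟩
    left_inv := fun g => Subtype.ext (funext fun a => congrArg g.1 (e.symm_apply_apply a))
    right_inv := fun g => Subtype.ext (funext fun b => congrArg g.1 (e.apply_symm_apply b))
    map_mul' := fun _ _ => rfl
    map_add' := fun _ _ => rfl
    commutes' := fun _ => rfl }⟩

end RegularFunctions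

/-! ### The Makar-Limanov invariant of affine space -/

section MakarLimanov

open MvPolynomial

theorem makarLimanovAlgebra_apply_mem {A B : Type*} [CommRing A] [Algebra ℂ A] [CommRing B]
    [Algebra ℂ B] (e : A ≃ₐ[ℂ] B) {a : A} (ha : a ∈ makarLimanovAlgebra A) :
    e a ∈ makarLimanovAlgebra B := by
  intro D hD
  let E : Derivation ℂ A A := Derivation.mk'
    (e.symm.toLinearMap ∘ₗ D.toLinearMap ∘ₗ e.toLinearMap) fun a b => by
      simp
  have hE : ∀ a, E a = e.symm (D (e a)) := fun a => rfl
  have hEn : ∀ (n : ℕ) (a : A), E^[n] a = e.symm (D^[n] (e a)) := by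
    intro n
    induction n with
    | zero => intro a; simp
    | succ n ih => intro a; rw [Function.iterate_succ_apply', ih, hE, e.apply_symm_apply,
        Function.iterate_succ_apply']
  have h := ha E fun a => by
    obtain ⟨n, hn⟩ := hD (e a)
    exact ⟨n, by rw [hEn, hn, map_zero]⟩
  rwa [hE, map_eq_zero_iff _ e.symm.injective] at h

theorem isLocallyNilpotentDerivation_pderiv {σ : Type*} (i : σ) :
    IsLocallyNilpotentDerivation (pderiv i : Derivation ℂ (MvPolynomial σ ℂ) _) := by
  classical
  intro p
  induction p using MvPolynomial.induction_on with
  | C c => exact ⟨1, pderiv_C⟩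
  | add p q hp hq => exact Derivation.exists_iterate_add_eq_zero hp hq
  | mul_X p j hp =>
    refine Derivation.exists_iterate_mul_eq_zero hp ⟨2, ?_⟩
    rw [Function.iterate_succ_apply, Function.iterate_one, pderiv_X]
    by_cases h : j = i
    · subst h; simp
    · simp [h]

theorem MvPolynomial.eq_C_of_pderiv_eq_zero {σ : Type*} {p : MvPolynomial σ ℂ}
    (h : ∀ i, pderiv i p = 0) : p = C (coeff 0 p) := by
  classical
  ext d
  rw [coeff_C]
  split_ifs with hd
  · rw [hd]
  · obtain ⟨i, hi⟩ := Finsupp.ne_iff.1 (Ne.symm hd)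
    have hle : Finsupp.single i 1 ≤ d := by
      rw [Finsupp.single_le_iff]
      exact Nat.one_le_iff_ne_zero.2 hi
    have := coeff_pderiv (i := i) p (d - Finsupp.single i 1)
    rw [h i, tsub_add_cancel_of_le hle, coeff_zero] at this
    exact (mul_eq_zero.1 this.symm).resolve_right (Nat.cast_add_one_ne_zero _)

theorem makarLimanovAlgebra_mvPolynomial (σ : Type*) :
    makarLimanovAlgebra (MvPolynomial σ ℂ) = ⊥ := by
  refine eq_bot_iff.2 fun p hp => ?_
  rw [eq_C_of_pderiv_eq_zero fun i => hp _ (isLocallyNilpotentDerivation_pderiv i)]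
  exact Subalgebra.algebraMap_mem _ _

theorem ML_affineSpaceC (n : ℕ) : ML (affineSpaceC n) = ⊥ := by
  have hinj : Function.Injective (regularFunctions.restrict (affineSpaceC n)) := by
    intro p p' h
    refine MvPolynomial.funext fun a => ?_
    have := congrFun (congrArg Subtype.val h) ⟨a, Set.mem_univ a⟩
    rwa [regularFunctions.restrict_apply, regularFunctions.restrict_apply] at this
  let e := AlgEquiv.ofBijective _ ⟨hinj, regularFunctions.restrict_surjective (affineSpaceC n)⟩
  refine eq_bot_iff.2 fun f hf => ?_
  have h := makarLimanovAlgebra_apply_mem e.symm hf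
  rw [makarLimanovAlgebra_mvPolynomial, Algebra.mem_bot] at h
  obtain ⟨c, hc⟩ := h
  rw [← e.apply_symm_apply f, ← hc, e.commutes]
  exact Subalgebra.algebraMap_mem _ _

end MakarLimanov

/-! ### The grading defined by an action of the multiplicative group -/

section Grading

open MvPolynomial DirectSum

variable {σ : Type*} (X : Set (σ → ℂ)) (w : σ → ℤ)

/-- The restrictions to `X` of the weighted homogeneous polynomials of degree `i`. -/
noncomputable def weightGrading (i : ℤ) : Submodule ℂ (regularFunctions X) :=
  (weightedHomogeneousSubmodule ℂ w i).map (regularFunctions.restrict X).toLinearMap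

variable {X w}

theorem coordFunction_mem_weightGrading (j : σ) :
    coordFunction X j ∈ weightGrading X w (w j) :=
  ⟨MvPolynomial.X j, isWeightedHomogeneous_X ℂ w j, by simp [regularFunctions.restrict]⟩

theorem coordFunction_dvd_of_mem_weightGrading {i : ℤ} {j : σ}
    (h : ∀ d : σ →₀ ℕ, Finsupp.weight w d = i → d j ≠ 0) {a : regularFunctions X}
    (ha : a ∈ weightGrading X w i) : coordFunction X j ∣ a := by
  obtain ⟨p, hp, rfl⟩ := ha
  have hdvd : MvPolynomial.X j ∣ p := by
    rw [p.as_sum]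
    refine Finset.dvd_sum fun d hd => X_dvd_monomial.2 (Or.inr (h d (hp (mem_support_iff.1 hd))))
  have := map_dvd (regularFunctions.restrict X) hdvd
  rwa [regularFunctions.restrict, aeval_X] at this

theorem MvPolynomial.IsWeightedHomogeneous.eval_zpow_mul [Fintype σ] {i : ℤ}
    {p : MvPolynomial σ ℂ} (hp : IsWeightedHomogeneous w p i) {t : ℂ} (ht : t ≠ 0) (a : σ → ℂ) :
    eval (fun j => t ^ w j * a j) p = t ^ i * eval a p := by
  rw [eval_eq', eval_eq', Finset.mul_sum]
  refine Finset.sum_congr rfl fun d hd => ?_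
  rw [← hp (mem_support_iff.1 hd), Finsupp.weight_apply,
    Finsupp.sum_fintype _ _ (by simp)]
  have : ∏ j, (t ^ w j * a j) ^ d j = t ^ (∑ j, d j • w j) * ∏ j, a j ^ d j := by
    induction (Finset.univ : Finset σ) using Finset.cons_induction with
    | empty => simp
    | cons j s hj ih =>
      rw [Finset.prod_cons, Finset.prod_cons, Finset.sum_cons, ih, zpow_add₀ ht, nsmul_eq_mul,
        mul_comm (d j : ℤ), zpow_mul, zpow_natCast]
      ring
  rw [this]
  ring

theorem isInternal_weightGrading [Fintype σ]
    (hX : ∀ a ∈ X, (fun j => (2 : ℂ) ^ w j * a j) ∈ X) : IsInternal (weightGrading X w) := by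
  refine isInternal_submodule_of_iSupIndep_of_iSup_eq_top ?_ ?_
  · have hreg : IsRegularMap fun a : X => (⟨_, hX a.1 a.2⟩ : X) := fun j =>
      ⟨C ((2 : ℂ) ^ w j) * MvPolynomial.X j, fun a => by simp⟩
    -- The submodules lie in eigenspaces of the pullback along the action of `2`.
    let T : Module.End ℂ (regularFunctions X) :=
      { toFun := fun g => ⟨fun a => g.1 ⟨_, hX a.1 a.2⟩, hreg.comp_mem g⟩
        map_add' := fun _ _ => rfl
        map_smul' := fun _ _ => rfl }
    have hinj : Function.Injective fun i : ℤ => (2 : ℂ) ^ i := fun i j h => by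
      have h' : (((2 : ℝ) ^ i : ℝ) : ℂ) = ((2 : ℝ) ^ j : ℝ) := by
        push_cast
        exact h
      exact zpow_right_injective₀ two_pos (by norm_num) (Complex.ofReal_injective h')
    refine (T.eigenspaces_iSupIndep.comp hinj).mono fun i => ?_
    rintro _ ⟨p, hp, rfl⟩
    rw [Function.comp_apply, Module.End.mem_eigenspace_iff]
    refine Subtype.ext (funext fun a => ?_)
    exact (regularFunctions.restrict_apply p _).trans
      ((IsWeightedHomogeneous.eval_zpow_mul hp two_ne_zero a.1).trans
        (congrArg _ (regularFunctions.restrict_apply p a).symm))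
  · refine eq_top_iff.2 fun f _ => ?_
    obtain ⟨p, rfl⟩ := regularFunctions.restrict_surjective X f
    rw [p.as_sum, map_sum]
    exact Submodule.sum_mem _ fun d _ => Submodule.mem_iSup_of_mem (Finsupp.weight w d)
      ⟨_, isWeightedHomogeneous_monomial w d _ rfl, rfl⟩

/-- The algebra of a closed subset that is stable under the action of the multiplicative group with
weights `w` is graded. Stability under the single element `2`, of infinite order, suffices. -/
@[reducible]
noncomputable def weightGradedAlgebra [Fintype σ]
    (hX : ∀ a ∈ X, (fun j => (2 : ℂ) ^ w j * a j) ∈ X) : GradedAlgebra (weightGrading X w) where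
  one_mem := ⟨1, isWeightedHomogeneous_one ℂ w, map_one (regularFunctions.restrict X)⟩
  mul_mem := by
    rintro i j _ _ ⟨p, hp, rfl⟩ ⟨p', hp', rfl⟩
    exact ⟨p * p', IsWeightedHomogeneous.mul hp hp', map_mul (regularFunctions.restrict X) _ _⟩
  toDecomposition := (isInternal_weightGrading hX).chooseDecomposition

end Grading

/-! ### The hypersurface -/

namespace MiyanishiHypersurface

open MvPolynomial

theorem map_q {R S : Type*} [CommRing R] [CommRing S] {F : Type*} [FunLike F R S]
    [RingHomClass F R S] (f : F) (k l : ℕ) (x y z : R) :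
    f (q k l x y z) = q k l (f x) (f y) (f z) := by
  simp [q]

theorem q_zero {R : Type*} [CommRing R] (k l : ℕ) : q k l (0 : R) 0 0 = 1 := by
  simp [q]

variable {k l m : ℕ}

theorem eval_p (a : Fin 5 → ℂ) :
    eval a (p k l m) = a 3 ^ m * a 4 + q k l (a 0) (a 1) (a 2) := by
  simp [p, map_q (eval a)]

theorem mem_hypersurface_iff (a : Fin 5 → ℂ) :
    a ∈ hypersurface k l m ↔ a 3 ^ m * a 4 + q k l (a 0) (a 1) (a 2) = 0 := by
  rw [← eval_p]
  rfl

theorem point_mem_hypersurface (k l m : ℕ) (x y z : ℂ) {u : ℂ} (hu : u ≠ 0) :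
    ![x, y, z, u, -q k l x y z / u ^ m] ∈ hypersurface k l m := by
  rw [mem_hypersurface_iff]
  have : u ^ m ≠ 0 := pow_ne_zero _ hu
  simp
  field_simp
  ring

/-- Modulo `p`, a multiple of any polynomial by a power of `u` does not involve `v`. -/
theorem exists_dvd_pow_mul_sub_rename (k l m : ℕ) (f : MvPolynomial (Fin 5) ℂ) :
    ∃ (N : ℕ) (g : MvPolynomial (Fin 4) ℂ), p k l m ∣ X 3 ^ N * f - rename Fin.castSucc g := by
  induction f using MvPolynomial.induction_on with
  | C c => exact ⟨0, C c, by simp⟩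
  | add f₁ f₂ h₁ h₂ =>
    obtain ⟨N₁, g₁, r₁, h₁⟩ := h₁
    obtain ⟨N₂, g₂, r₂, h₂⟩ := h₂
    refine ⟨N₁ + N₂, X 3 ^ N₂ * g₁ + X 3 ^ N₁ * g₂, X 3 ^ N₂ * r₁ + X 3 ^ N₁ * r₂, ?_⟩
    have e : rename Fin.castSucc (X 3 : MvPolynomial (Fin 4) ℂ) = X 3 := rename_X _ _
    simp only [map_add, map_mul, map_pow, e]
    linear_combination X 3 ^ N₂ * h₁ + X 3 ^ N₁ * h₂
  | mul_X f i h =>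
    obtain ⟨N, g, r, h⟩ := h
    induction i using Fin.lastCases with
    | last =>
      refine ⟨N + m, -q k l (X 0) (X 1) (X 2) * g,
        X 3 ^ N * f - q k l (X 0) (X 1) (X 2) * r, ?_⟩
      have e : rename Fin.castSucc (q k l (X 0) (X 1) (X 2) : MvPolynomial (Fin 4) ℂ) =
          q k l (X 0) (X 1) (X 2) := by
        rw [map_q, rename_X, rename_X, rename_X]
        rfl
      have e4 : (X (Fin.last 4) : MvPolynomial (Fin 5) ℂ) = X 4 := rfl
      rw [map_mul, map_neg, e, e4]
      have hp : p k l m = X 3 ^ m * X 4 + q k l (X 0) (X 1) (X 2) := rfl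
      rw [pow_add]
      linear_combination (-q k l (X 0) (X 1) (X 2)) * h - X 3 ^ N * f * hp
    | cast j =>
      refine ⟨N, g * X j, r * X j.castSucc, ?_⟩
      rw [map_mul, rename_X]
      linear_combination X j.castSucc * h

theorem p_dvd_of_dvd_pow_mul (hm : m ≠ 0) {N : ℕ} {f : MvPolynomial (Fin 5) ℂ}
    (h : p k l m ∣ X 3 ^ N * f) : p k l m ∣ f := by
  obtain ⟨r, hr⟩ := h
  have hnd : ¬ (X 3 : MvPolynomial (Fin 5) ℂ) ∣ p k l m := fun h => by
    have := map_dvd (eval (0 : Fin 5 → ℂ)) h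
    rw [eval_p] at this
    simp [hm, q_zero] at this
  obtain ⟨r', rfl⟩ :=
    (X_prime (i := (3 : Fin 5)) (R := ℂ)).pow_dvd_of_dvd_mul_left N hnd ⟨f, hr.symm⟩
  refine ⟨r', mul_left_cancel₀ (pow_ne_zero N (X_ne_zero (3 : Fin 5))) ?_⟩
  rw [hr]
  ring

theorem restrict_eq_zero_of_p_dvd {f : MvPolynomial (Fin 5) ℂ} (h : p k l m ∣ f) :
    regularFunctions.restrict (hypersurface k l m) f = 0 := by
  obtain ⟨r, rfl⟩ := h
  refine Subtype.ext (funext fun a => ?_)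
  rw [regularFunctions.restrict_apply, map_mul, show eval a.1 (p k l m) = 0 from a.2, zero_mul]
  rfl

/-- A product that vanishes on the hypersurface vanishes where `u ≠ 0`. This part is a product of
`ℂ³` and the punctured line, so one factor vanishes there, and then everywhere since `u` does not
divide `p`. -/
theorem isDomain_regularFunctions (k l : ℕ) (hm : m ≠ 0) :
    IsDomain (regularFunctions (hypersurface k l m)) := by
  have : Nontrivial (regularFunctions (hypersurface k l m)) := by
    refine ⟨0, 1, fun h => ?_⟩
    have := congrFun (congrArg Subtype.val h) ⟨_, point_mem_hypersurface k l m 0 0 0 one_ne_zero⟩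
    exact zero_ne_one this
  have : NoZeroDivisors (regularFunctions (hypersurface k l m)) := by
    refine ⟨fun {a₁ a₂} h => ?_⟩
    obtain ⟨f₁, rfl⟩ := regularFunctions.restrict_surjective _ a₁
    obtain ⟨f₂, rfl⟩ := regularFunctions.restrict_surjective _ a₂
    obtain ⟨N₁, g₁, h₁⟩ := exists_dvd_pow_mul_sub_rename k l m f₁
    obtain ⟨N₂, g₂, h₂⟩ := exists_dvd_pow_mul_sub_rename k l m f₂
    have key : X 3 * (g₁ * g₂) = 0 := by
      refine MvPolynomial.funext fun b => ?_
      rw [map_mul, eval_X, map_zero]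
      by_cases hb : b 3 = 0
      · rw [hb, zero_mul]
      let P : hypersurface k l m := ⟨_, point_mem_hypersurface k l m (b 0) (b 1) (b 2) hb⟩
      have hP : P.1 ∘ Fin.castSucc = b := by
        funext j
        fin_cases j <;> rfl
      have hval : ∀ {N : ℕ} {f : MvPolynomial (Fin 5) ℂ} {g : MvPolynomial (Fin 4) ℂ},
          p k l m ∣ X 3 ^ N * f - rename Fin.castSucc g → eval b g = b 3 ^ N * eval P.1 f := by
        rintro N f g ⟨r, hr⟩
        have := congrArg (eval P.1) hr
        rw [map_mul, show eval P.1 (p k l m) = 0 from P.2, zero_mul, map_sub, eval_rename, hP,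
          map_mul, map_pow, eval_X, sub_eq_zero] at this
        exact this.symm
      have h12 : eval P.1 f₁ * eval P.1 f₂ = 0 := by
        have := congrFun (congrArg Subtype.val h) P
        rwa [← map_mul, regularFunctions.restrict_apply, map_mul] at this
      rw [map_mul, hval h₁, hval h₂]
      linear_combination b 3 * b 3 ^ N₁ * b 3 ^ N₂ * h12
    rcases mul_eq_zero.1 ((mul_eq_zero.1 key).resolve_left (X_ne_zero _)) with h0 | h0
    · rw [h0, map_zero, sub_zero] at h₁
      exact Or.inl (restrict_eq_zero_of_p_dvd (p_dvd_of_dvd_pow_mul hm h₁))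
    · rw [h0, map_zero, sub_zero] at h₂
      exact Or.inr (restrict_eq_zero_of_p_dvd (p_dvd_of_dvd_pow_mul hm h₂))
  exact NoZeroDivisors.to_isDomain _

/-- The weights of the variables for which `p` is quasi-homogeneous of degree zero. -/
def weights (m : ℕ) : Fin 5 → ℤ := ![0, 0, 0, 1, -m]

theorem weight_weights (d : Fin 5 →₀ ℕ) :
    Finsupp.weight (weights m) d = d 3 - m * d 4 := by
  rw [Finsupp.weight_apply, Finsupp.sum_fintype _ _ (by simp), Fin.sum_univ_five]
  simp [weights]
  ring

theorem scale_mem_hypersurface {a : Fin 5 → ℂ} (ha : a ∈ hypersurface k l m) :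
    (fun j => (2 : ℂ) ^ weights m j * a j) ∈ hypersurface k l m := by
  rw [mem_hypersurface_iff] at ha ⊢
  have h2 : (2 : ℂ) ^ m ≠ 0 := pow_ne_zero _ two_ne_zero
  rw [← ha]
  simp only [weights, Matrix.cons_val, zpow_neg, zpow_natCast, zpow_one, zpow_zero, one_mul]
  rw [mul_pow]
  field_simp

/-- Every locally nilpotent derivation of the algebra of the hypersurface annihilates `u`. -/
theorem apply_uBar_eq_zero (hm : 2 ≤ m) (hl : 3 ≤ l) (hkl : l < k)
    {D : Derivation ℂ (regularFunctions (hypersurface k l m))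
      (regularFunctions (hypersurface k l m))} (hD : IsLocallyNilpotentDerivation D) :
    D (uBar k l m) = 0 := by
  have := isDomain_regularFunctions k l (by omega : m ≠ 0)
  let _ := weightGradedAlgebra (X := hypersurface k l m) (w := weights m)
    (fun a => scale_mem_hypersurface)
  -- All functions that have to be nonzero are nonzero at the point with `x = y = z = u = 1`.
  let c := coordFunction (hypersurface k l m)
  let P : hypersurface k l m := ⟨_, point_mem_hypersurface k l m 1 1 1 one_ne_zero⟩
  have hne : ∀ {f : regularFunctions (hypersurface k l m)}, f.1 P ≠ 0 → f ≠ 0 := by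
    rintro _ h rfl
    exact h rfl
  have hq : q k l (1 : ℂ) 1 1 = 2 ^ k - 2 ^ l + 1 := by
    have := mul_q k l (1 : ℂ) 1 1
    norm_num at this
    linear_combination this
  have hlt : (2 : ℕ) ^ l < 2 ^ k := Nat.pow_lt_pow_right (by norm_num) hkl
  have hrel : c 3 ^ m * c 4 + q k l (c 0) (c 1) (c 2) = 0 := by
    have := restrict_eq_zero_of_p_dvd (dvd_refl (p k l m))
    simpa [p, regularFunctions.restrict, map_q] using this
  have hgen : Algebra.adjoin ℂ {c 0, c 1, c 2, c 3, c 4} = ⊤ := by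
    rw [eq_top_iff, ← regularFunctions.adjoin_range_coordFunction]
    refine Algebra.adjoin_mono ?_
    rintro _ ⟨j, rfl⟩
    fin_cases j <;> simp [c]
  refine hD.apply_eq_zero_of_graded (weightGrading (hypersurface k l m) (weights m)) (x := c 0)
    (y := c 1) (z := c 2) (u := c 3) (v := c 4) hm hl hkl hgen
    (coordFunction_mem_weightGrading 0) (coordFunction_mem_weightGrading 1)
    (coordFunction_mem_weightGrading 2) (coordFunction_mem_weightGrading 3)
    (coordFunction_mem_weightGrading 4) (hne one_ne_zero) (hne one_ne_zero) (hne one_ne_zero)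
    (hne ?_) (hne ?_) (hne one_ne_zero) (hne ?_) (hne ?_) hrel ?_ ?_ ?_
  · change (1 : ℂ) * 1 + 1 ≠ 0
    norm_num
  · change (1 : ℂ) * 1 + 1 ≠ 0
    norm_num
  · change -q k l (1 : ℂ) 1 1 / 1 ^ m ≠ 0
    rw [hq]
    intro h
    have h' : ((2 ^ k + 1 : ℕ) : ℂ) = (2 ^ l : ℕ) := by
      push_cast
      rw [one_pow, div_one] at h
      linear_combination -h
    have := Nat.cast_injective h'
    omega
  · change 1 + -q k l (1 : ℂ) 1 1 / 1 ^ m * 1 ^ m ≠ 0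
    rw [hq]
    intro h
    have h' : ((2 ^ k : ℕ) : ℂ) = (2 ^ l : ℕ) := by
      push_cast
      rw [one_pow, div_one] at h
      linear_combination -h
    have := Nat.cast_injective h'
    omega
  · intro i hi a ha
    refine coordFunction_dvd_of_mem_weightGrading (fun d hd h0 => ?_) ha
    rw [weight_weights, h0] at hd
    have : 0 ≤ (m : ℤ) * d 4 := by positivity
    push_cast at hd
    omega
  · intro i hi a ha
    refine coordFunction_dvd_of_mem_weightGrading (fun d hd h0 => ?_) ha
    rw [weight_weights, h0] at hd
    push_cast at hd
    omega
  · intro i hi a ha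
    refine coordFunction_dvd_of_mem_weightGrading (fun d hd h0 => hi ?_) ha
    rw [weight_weights, h0] at hd
    exact ⟨-d 4, by rw [← hd]; push_cast; ring⟩

theorem uBar_ne_algebraMap (k l m : ℕ) (c : ℂ) :
    uBar k l m ≠ algebraMap ℂ (regularFunctions (hypersurface k l m)) c := by
  intro h
  have h1 := congrFun (congrArg Subtype.val h)
    ⟨_, point_mem_hypersurface k l m 0 0 0 one_ne_zero⟩
  have h2 := congrFun (congrArg Subtype.val h)
    ⟨_, point_mem_hypersurface k l m 0 0 0 two_ne_zero⟩
  change (1 : ℂ) = c at h1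
  change (2 : ℂ) = c at h2
  rw [← h2] at h1
  norm_num at h1

end MiyanishiHypersurface

theorem proposition1 (k l m : ℕ) (hm : 2 ≤ m) (hl : 3 ≤ l) (hkl : l < k)
    (hcop : Nat.Coprime k l) :
    Algebra.adjoin ℂ {MiyanishiHypersurface.uBar k l m} ≤ ML (MiyanishiHypersurface.hypersurface k l m) ∧
    (∀ D : Derivation ℂ (regularFunctions (MiyanishiHypersurface.hypersurface k l m))
        (regularFunctions (MiyanishiHypersurface.hypersurface k l m)),
      IsLocallyNilpotentDerivation D → D (MiyanishiHypersurface.uBar k l m) = 0) ∧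
    ML (MiyanishiHypersurface.hypersurface k l m) ≠ ⊥ ∧
    ML (affineSpaceC 4) = ⊥ ∧
    IsEmpty (ML (MiyanishiHypersurface.hypersurface k l m) ≃ₐ[ℂ] ML (affineSpaceC 4)) ∧
    ¬ BiregularlyIsomorphic (MiyanishiHypersurface.hypersurface k l m) (affineSpaceC 4) := by
  have hu : MiyanishiHypersurface.uBar k l m ∈ ML (MiyanishiHypersurface.hypersurface k l m) :=
    fun D hD => MiyanishiHypersurface.apply_uBar_eq_zero hm hl hkl hD
  refine ⟨Algebra.adjoin_le (Set.singleton_subset_iff.2 hu),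
    fun D hD => MiyanishiHypersurface.apply_uBar_eq_zero hm hl hkl hD, fun h => ?_,
    ML_affineSpaceC 4, ⟨fun e => ?_⟩,
    fun h => ?_⟩
  · rw [h, Algebra.mem_bot] at hu
    obtain ⟨c, hc⟩ := hu
    exact MiyanishiHypersurface.uBar_ne_algebraMap k l m c hc.symm
  · obtain ⟨c, hc⟩ := Algebra.mem_bot.1 ((ML_affineSpaceC 4).le (e ⟨_, hu⟩).2)
    have h' : e ⟨_, hu⟩ = e (algebraMap ℂ _ c) := by
      rw [e.commutes]
      exact Subtype.ext hc.symm
    exact MiyanishiHypersurface.uBar_ne_algebraMap k l m c (congrArg Subtype.val (e.injective h'))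
  · obtain ⟨e⟩ := h.nonempty_algEquiv
    have h : e (MiyanishiHypersurface.uBar k l m) ∈ ML (affineSpaceC 4) :=
      makarLimanovAlgebra_apply_mem e hu
    rw [ML_affineSpaceC, Algebra.mem_bot] at h
    obtain ⟨c, hc⟩ := h
    rw [← e.commutes] at hc
    exact MiyanishiHypersurface.uBar_ne_algebraMap k l m c (e.injective hc).symm
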